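/- Let $\mathcal R_1\subset\mathcal R_2$ be von Neumann algebras acting on a complex Hilbert space $\mathcal H$, and let $\Omega,\tilde\Omega\in\mathcal H$ be vectors that are standard (cyclic and separating) for both $\mathcal R_1$ and $\mathcal R_2$. For $i=1,2$ let $S^{(i)}_{\tilde\Omega,\Omega}$ be the closure of the antilinear operator $a\Omega\mapsto a^*\tilde\Omega$ ($a\in\mathcal R_i$), let $\Delta^{(i)}_{\tilde\Omega,\Omega}=(S^{(i)}_{\tilde\Omega,\Omega})^*S^{(i)}_{\tilde\Omega,\Omega}$ be the relative modular operator, and let $K^{(i)}_{\tilde\Omega,\Omega}=-\log\Delta^{(i)}_{\tilde\Omega,\Omega}$ be the relative modular Hamiltonian, defined by Borel functional calculus. For a self-adjoint operator $A$ with spectral measure $E$ and $\psi\in\mathcal H$ put $q_A^{\pm}(\psi)=\int \max(\pm x,0)\,d\langle\psi,E(x)\psi\rangle\in[0,\infty]$ and $q_A(\psi)=q_A^+(\psi)-q_A^-(\psi)\in[-\infty,\infty]$, which is defined if $q_A^+(\psi)$ and $q_A^-(\psi)$ are not both infinite. Write $A\le B$ if, for all $\psi\in\mathcal H$: $q_B^+(\psi)<\infty$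 implies $q_A^+(\psi)<\infty$; $q_A^-(\psi)<\infty$ implies $q_B^-(\psi)<\infty$; and $q_A(\psi)\le q_B(\psi)$ whenever both are defined. (For operators bounded below this is the usual order of quadratic forms.) Let $H^{(i)}(\Omega,\tilde\Omega)=\langle\Omega,K^{(i)}_{\tilde\Omega,\Omega}\Omega\rangle:=q_{K^{(i)}_{\tilde\Omega,\Omega}}(\Omega)$ be the relative entropy. Then these objects are well defined: each $\Delta^{(i)}_{\tilde\Omega,\Omega}$ has a unique spectral measure and is strictly positive, each $K^{(i)}_{\tilde\Omega,\Omega}$ is self-adjoint with a unique spectral measure, and $H^{(i)}(\Omega,\tilde\Omega)\in(-\infty,\infty]$. Moreover $$K^{(1)}_{\tilde\Omega,\Omega}\le K^{(2)}_{\tilde\Omega,\Omega}\qquad\text{and}\qquad H^{(1)}(\Omega,\tilde\Omega)\le H^{(2)}(\Omega,\tilde\Omega).$$ -/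

import Mathlib

open MeasureTheory Set
open scoped ENNReal

noncomputable section

namespace ModularTheory

variable {H : Type*} [NormedAddCommGroup H] [InnerProductSpace ℂ H] [CompleteSpace H]

/-! ### Spectral resolutions and Borel functional calculus -/

variable (H) in
/-- A projection-valued Borel measure on `ℝ` with values in the orthogonal projections of `H`,
countably additive in the strong operator topology.  (Orthogonality of the projections of disjoint
sets is a consequence.)  The value on non-measurable sets is normalised to `0`, so that two
resolutions are equal as soon as they agree on Borel sets. -/
@[ext]
structure SpectralResolution where
  proj : Set ℝ → H →L[ℂ] H
  isStarProjection : ∀ s, MeasurableSet s → IsStarProjection (proj s)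
  not_measurable : ∀ s, ¬ MeasurableSet s → proj s = 0
  proj_univ : proj univ = 1
  hasSum_iUnion : ∀ s : ℕ → Set ℝ, (∀ n, MeasurableSet (s n)) →
    Pairwise (Function.onFun Disjoint s) →
    ∀ ψ : H, HasSum (fun n => proj (s n) ψ) (proj (⋃ n, s n) ψ)

namespace SpectralResolution

variable (E : SpectralResolution H)

theorem proj_empty : E.proj ∅ = 0 := by
  ext ψ
  have h := E.hasSum_iUnion (fun _ => ∅) (fun _ => MeasurableSet.empty)
    (fun _ _ _ => disjoint_bot_left) ψ
  have h0 := h.summable.tendsto_atTop_zero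
  simpa using tendsto_nhds_unique tendsto_const_nhds h0

theorem inner_proj {s : Set ℝ} (hs : MeasurableSet s) (ψ : H) :
    RCLike.re (inner ℂ ψ (E.proj s ψ)) = ‖E.proj s ψ‖ ^ 2 := by
  have hP := E.isStarProjection s hs
  have h1 : E.proj s (E.proj s ψ) = E.proj s ψ := DFunLike.congr_fun hP.isIdempotentElem ψ
  have h2 : inner ℂ (E.proj s ψ) (E.proj s ψ) = inner ℂ ψ (E.proj s (E.proj s ψ)) := by
    have h := ContinuousLinearMap.adjoint_inner_right (E.proj s) ψ (E.proj s ψ)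
    rw [← ContinuousLinearMap.star_eq_adjoint, hP.isSelfAdjoint.star_eq] at h
    exact h.symm
  rw [← h1, ← h2, h1]
  exact inner_self_eq_norm_sq (𝕜 := ℂ) _

/-- The scalar spectral measure `s ↦ ⟪ψ, E(s) ψ⟫ = ‖E(s) ψ‖²`. -/
def measure (ψ : H) : Measure ℝ :=
  Measure.ofMeasurable (fun s _ => ENNReal.ofReal (‖E.proj s ψ‖ ^ 2))
    (by simp [E.proj_empty])
    (by
      intro s hs hd
      have h := E.hasSum_iUnion s hs hd ψ
      have h' : HasSum (fun n => ‖E.proj (s n) ψ‖ ^ 2) (‖E.proj (⋃ n, s n) ψ‖ ^ 2) := by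
        have h2 := RCLike.hasSum_re ℂ (h.mapL (innerSL ℂ ψ))
        simpa only [innerSL_apply_apply, E.inner_proj (hs _),
          E.inner_proj (MeasurableSet.iUnion hs)] using h2
      rw [← h'.tsum_eq, ENNReal.ofReal_tsum_of_nonneg (fun _ => by positivity) h'.summable])

/-- `A` is the operator `∫ f(x) dE(x)`: its domain consists of the `ψ` with
`∫ |f|² d⟪ψ, E ψ⟫ < ∞`, and `⟪ψ, A ψ⟫ = ∫ f d⟪ψ, E ψ⟫` there
(by polarization this determines `A`). -/
def IsIntegral (f : ℝ → ℝ) (A : H →ₗ.[ℂ] H) : Prop :=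
  (∀ ψ : H, ψ ∈ A.domain ↔ ∫⁻ x, ENNReal.ofReal (f x ^ 2) ∂(E.measure ψ) < ⊤) ∧
  ∀ ψ : A.domain, inner ℂ (ψ : H) (A ψ) = ((∫ x, f x ∂(E.measure (ψ : H)) : ℝ) : ℂ)

/-- `E` is the spectral resolution of `A`, i.e. `A = ∫ x dE(x)`. -/
def IsResolutionOf (A : H →ₗ.[ℂ] H) : Prop := E.IsIntegral (fun x => x) A

variable (H) in
open Classical in
/-- The spectral resolution of the zero operator. -/
def dirac : SpectralResolution H where
  proj s := if MeasurableSet s ∧ (0 : ℝ) ∈ s then 1 else 0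
  isStarProjection s _ := by
    split_ifs
    · exact IsStarProjection.one _
    · exact IsStarProjection.zero _
  not_measurable s hs := by simp [hs]
  proj_univ := by simp
  hasSum_iUnion s hs hd ψ := by
    by_cases h : ∃ n, (0 : ℝ) ∈ s n
    · obtain ⟨n, hn⟩ := h
      have h1 : ∀ m, m ≠ n → (0 : ℝ) ∉ s m := fun m hm h0 =>
        Set.disjoint_left.1 (hd hm) h0 hn
      have h2 : MeasurableSet (⋃ n, s n) ∧ (0 : ℝ) ∈ ⋃ n, s n :=
        ⟨MeasurableSet.iUnion hs, Set.mem_iUnion.2 ⟨n, hn⟩⟩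
      rw [if_pos h2]
      convert hasSum_single n (f := fun m => (if MeasurableSet (s m) ∧ (0 : ℝ) ∈ s m
        then (1 : H →L[ℂ] H) else 0) ψ) (fun m hm => by simp [h1 m hm]) using 1
      simp [hs n, hn]
    · push Not at h
      simp [h, hasSum_zero]

end SpectralResolution

open Classical in
/-- The spectral resolution of a self-adjoint operator `A`
(junk value if `A` has no spectral resolution). -/
def spectralResolution (A : H →ₗ.[ℂ] H) : SpectralResolution H :=
  if h : ∃ E : SpectralResolution H, E.IsResolutionOf A then h.choose
  else SpectralResolution.dirac H

open Classical in
/-- The operator `f(A) = ∫ f(x) dE(x)`, where `E` is the spectral resolution of the self-adjoint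
operator `A`. -/
def functionalCalculus (f : ℝ → ℝ) (A : H →ₗ.[ℂ] H) : H →ₗ.[ℂ] H :=
  if h : ∃ B : H →ₗ.[ℂ] H, (spectralResolution A).IsIntegral f B then h.choose else 0

/-! ### Quadratic forms of self-adjoint operators -/

/-- `⟪ψ, A⁺ ψ⟫ ∈ [0, ∞]` for the positive part `A⁺` of a self-adjoint operator `A`, in the sense of
quadratic forms. -/
def formPos (A : H →ₗ.[ℂ] H) (ψ : H) : ℝ≥0∞ :=
  ∫⁻ x, ENNReal.ofReal x ∂((spectralResolution A).measure ψ)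

/-- `⟪ψ, A⁻ ψ⟫ ∈ [0, ∞]` for the negative part `A⁻` of a self-adjoint operator `A`, in the sense of
quadratic forms. -/
def formNeg (A : H →ₗ.[ℂ] H) (ψ : H) : ℝ≥0∞ :=
  ∫⁻ x, ENNReal.ofReal (-x) ∂((spectralResolution A).measure ψ)

/-- `⟪ψ, A ψ⟫` is defined in the sense of quadratic forms as an element of `[-∞, ∞]`. -/
def FormDefined (A : H →ₗ.[ℂ] H) (ψ : H) : Prop := formPos A ψ ≠ ⊤ ∨ formNeg A ψ ≠ ⊤

/-- `⟪ψ, A ψ⟫ ∈ [-∞, ∞]` in the sense of quadratic forms (meaningful if `FormDefined A ψ`). -/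
def quadForm (A : H →ₗ.[ℂ] H) (ψ : H) : EReal := (formPos A ψ : EReal) - (formNeg A ψ : EReal)

/-- The order `A ≤ B` of (not necessarily semibounded) self-adjoint operators, in the sense of
quadratic forms.  If both are bounded below, this is the usual form order: the form domain of `B`
is contained in that of `A`, and `⟪ψ, A ψ⟫ ≤ ⟪ψ, B ψ⟫` on the form domain of `B`. -/
structure FormLE (A B : H →ₗ.[ℂ] H) : Prop where
  pos_finite : ∀ ψ, formPos B ψ ≠ ⊤ → formPos A ψ ≠ ⊤
  neg_finite : ∀ ψ, formNeg A ψ ≠ ⊤ → formNeg B ψ ≠ ⊤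
  le : ∀ ψ, FormDefined A ψ → FormDefined B ψ → quadForm A ψ ≤ quadForm B ψ

/-! ### Relative modular theory -/

/-- `Ω` is a standard vector for `R`: it is cyclic and separating. -/
structure IsStandard (R : VonNeumannAlgebra H) (Ω : H) : Prop where
  cyclic : Dense {ψ : H | ∃ a ∈ R, a Ω = ψ}
  separating : ∀ a ∈ R, a Ω = 0 → a = 0

/-- The graph of the relative Tomita operator `S_{Ωt,Ω}`, i.e. of the closure of the antilinear
operator `a Ω ↦ a* Ωt`, `a ∈ R`. -/
def tomitaGraph (R : VonNeumannAlgebra H) (Ωt Ω : H) : Set (H × H) :=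
  closure {p | ∃ a ∈ R, p = (a Ω, star a Ωt)}

theorem tomitaGraph_zero (R : VonNeumannAlgebra H) (Ωt Ω : H) :
    (0 : H × H) ∈ tomitaGraph R Ωt Ω :=
  subset_closure ⟨0, zero_mem R, by simp; rfl⟩

theorem tomitaGraph_add (R : VonNeumannAlgebra H) (Ωt Ω : H) {p q : H × H}
    (hp : p ∈ tomitaGraph R Ωt Ω) (hq : q ∈ tomitaGraph R Ωt Ω) :
    p + q ∈ tomitaGraph R Ωt Ω := by
  refine map_mem_closure₂ continuous_add hp hq ?_
  rintro _ ⟨a, ha, rfl⟩ _ ⟨b, hb, rfl⟩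
  exact ⟨a + b, add_mem ha hb, by simp⟩

theorem tomitaGraph_smul (R : VonNeumannAlgebra H) (Ωt Ω : H) (c : ℂ) {p : H × H}
    (hp : p ∈ tomitaGraph R Ωt Ω) : (c • p.1, star c • p.2) ∈ tomitaGraph R Ωt Ω := by
  have hc : Continuous fun p : H × H => (c • p.1, star c • p.2) := by fun_prop
  refine map_mem_closure (f := fun p : H × H => (c • p.1, star c • p.2)) hc hp ?_
  rintro _ ⟨a, ha, rfl⟩
  exact ⟨c • a, R.toStarSubalgebra.smul_mem ha c, by simp [star_smul]⟩

/-- The graph of `S* S` for `S = S_{Ωt,Ω}`: it contains `(ψ, χ)` iff `ψ` is in the domain of `S`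
and `S ψ` is in the domain of `S*` with `S* S ψ = χ`.  The adjoint of an antilinear operator
is given by `⟪S* φ, ξ⟫ = ⟪S ξ, φ⟫` for all `ξ` in the domain of `S`. -/
def modularGraph (R : VonNeumannAlgebra H) (Ωt Ω : H) : Submodule ℂ (H × H) where
  carrier := {p | ∃ φ : H, (p.1, φ) ∈ tomitaGraph R Ωt Ω ∧
    ∀ q ∈ tomitaGraph R Ωt Ω, inner ℂ p.2 q.1 = inner ℂ q.2 φ}
  zero_mem' := ⟨0, tomitaGraph_zero R Ωt Ω, by simp⟩
  add_mem' := by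
    rintro p p' ⟨φ, h1, h2⟩ ⟨φ', h1', h2'⟩
    refine ⟨φ + φ', tomitaGraph_add R Ωt Ω h1 h1', fun q hq => ?_⟩
    rw [Prod.snd_add, inner_add_left, inner_add_right, h2 q hq, h2' q hq]
  smul_mem' := by
    rintro c p ⟨φ, h1, h2⟩
    refine ⟨star c • φ, tomitaGraph_smul R Ωt Ω c h1, fun q hq => ?_⟩
    rw [Prod.smul_snd, inner_smul_left, inner_smul_right, h2 q hq]; rfl

/-- The relative modular operator `Δ_{Ωt,Ω} = S* S`, `S = S_{Ωt,Ω}`, that is, the square of the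
positive part of the polar decomposition `S = J Δ^{1/2}`. -/
def relModularOperator (R : VonNeumannAlgebra H) (Ωt Ω : H) : H →ₗ.[ℂ] H :=
  (modularGraph R Ωt Ω).toLinearPMap

/-- The relative modular Hamiltonian `K_{Ωt,Ω} = -log Δ_{Ωt,Ω}`. -/
def relModularHamiltonian (R : VonNeumannAlgebra H) (Ωt Ω : H) : H →ₗ.[ℂ] H :=
  functionalCalculus (fun x => -Real.log x) (relModularOperator R Ωt Ω)

/-- The relative entropy `H(Ω, Ωt) = ⟪Ω, K_{Ωt,Ω} Ω⟫`, in the sense of quadratic forms. -/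
def relEntropy (R : VonNeumannAlgebra H) (Ω Ωt : H) : EReal :=
  quadForm (relModularHamiltonian R Ωt Ω) Ω

/-- The relative modular data are well defined (no junk value occurs): `Δ` has a unique spectral
resolution and is strictly positive, `-log Δ` exists and has a unique spectral resolution, and the
relative entropy `⟪Ω, K Ω⟫` is well defined in `(-∞, ∞]`. -/
structure WellDefined (R : VonNeumannAlgebra H) (Ωt Ω : H) : Prop where
  resolution : ∃! E : SpectralResolution H, E.IsResolutionOf (relModularOperator R Ωt Ω)
  pos : (spectralResolution (relModularOperator R Ωt Ω)).proj (Ioi 0) = 1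
  isLog : (spectralResolution (relModularOperator R Ωt Ω)).IsIntegral (fun x => -Real.log x)
    (relModularHamiltonian R Ωt Ω)
  isSelfAdjoint : IsSelfAdjoint (relModularHamiltonian R Ωt Ω)
  resolution_log : ∃! E : SpectralResolution H, E.IsResolutionOf (relModularHamiltonian R Ωt Ω)
  entropy : formNeg (relModularHamiltonian R Ωt Ω) Ω ≠ ⊤

end ModularTheory

end

open ModularTheory

noncomputable section

namespace ModularTheory

open Filter Topology

variable {H : Type*} [NormedAddCommGroup H] [InnerProductSpace ℂ H] [CompleteSpace H]

/-! ### Algebra of the spectral projections -/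

namespace SpectralResolution

variable (E : SpectralResolution H)

/-! Enlarging the algebra enlarges the graph of the Tomita operator `S`, and this increases the
resolvents of `Δ = S*S`. For `l > 0`, `⟪ψ, (Δ + l)⁻¹ ψ⟫` is the maximum of `2 Re⟪ψ, u⟫ - l‖u‖² -
‖v‖²` over `(u, v)` in the graph of `S` (`resolvent_variational`), so it grows with the graph
(`resolvent_mono`). In spectral terms, the Stieltjes transforms `∫ (x + l)⁻¹ dμ_ψ` are ordered
(`stieltjes_mono`).

This passes to `-log` by writing `-log x = (log (x+1) - log x) - log (x+1)`, where the first term is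
`∫₀¹ (x+l)⁻¹ dl` and the second is `∫₁^∞ (l⁻¹ - (x+l)⁻¹) dl`. Both are nonnegative, so Tonelli
applies. The first increases with the algebra; the second decreases, the total mass `‖ψ‖²` being the
same for both algebras. Up to a bounded error they are the positive and negative parts of `-log x`,
which yields all three clauses of the form order, infinite values included. For the entropy, the
competitor `l⁻¹ (Ω, Ωt)` bounds `‖Ω‖²/l - ⟪Ω, (Δ + l)⁻¹ Ω⟫` by `‖Ωt‖²/l²`, which is integrable at
infinity, so the negative part is finite.

The objects exist by the spectral theorem. Projecting `(ψ, 0)` orthogonally onto the graph of `S`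
gives `(1 + Δ)⁻¹`; this bounded operator is resolved through Riesz–Markov, and the resolution is
pushed forward under `t ↦ t⁻¹ - 1` (`exists_isResolutionOf_toLinearPMap`). Integrals of unbounded
functions come from the isometry of `L²(μ_ψ)` into `H`. A resolution is unique because the operator
determines the integrals of `(1+x²)⁻¹` and `x(1+x²)⁻¹`, which separate points. Strict positivity of
`Δ` comes from `Ωt` being separating, hence cyclic for the commutant. -/

theorem measure_apply {s : Set ℝ} (hs : MeasurableSet s) (ψ : H) :
    E.measure ψ s = ENNReal.ofReal (‖E.proj s ψ‖ ^ 2) :=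
  Measure.ofMeasurable_apply s hs

theorem measure_apply_enorm {s : Set ℝ} (hs : MeasurableSet s) (ψ : H) :
    E.measure ψ s = ‖E.proj s ψ‖ₑ ^ 2 := by
  rw [E.measure_apply hs, ENNReal.ofReal_pow (norm_nonneg _), ofReal_norm]

instance (ψ : H) : IsFiniteMeasure (E.measure ψ) :=
  ⟨by rw [E.measure_apply MeasurableSet.univ]; exact ENNReal.ofReal_lt_top⟩

theorem measure_univ_eq (ψ : H) : E.measure ψ univ = ‖ψ‖ₑ ^ 2 := by
  simp [E.measure_apply_enorm MeasurableSet.univ, E.proj_univ]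

theorem proj_proj {s : Set ℝ} (hs : MeasurableSet s) (ψ : H) :
    E.proj s (E.proj s ψ) = E.proj s ψ :=
  DFunLike.congr_fun (E.isStarProjection s hs).isIdempotentElem ψ

theorem inner_proj_left {s : Set ℝ} (hs : MeasurableSet s) (φ ψ : H) :
    inner ℂ (E.proj s φ) ψ = inner ℂ φ (E.proj s ψ) := by
  have h := ContinuousLinearMap.adjoint_inner_right (E.proj s) φ ψ
  rw [← ContinuousLinearMap.star_eq_adjoint, (E.isStarProjection s hs).isSelfAdjoint.star_eq] at h
  exact h.symm

theorem inner_proj_self {s : Set ℝ} (hs : MeasurableSet s) (ψ : H) :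
    inner ℂ ψ (E.proj s ψ) = ((‖E.proj s ψ‖ ^ 2 : ℝ) : ℂ) := by
  rw [← E.proj_proj hs, ← E.inner_proj_left hs, E.proj_proj hs, inner_self_eq_norm_sq_to_K]
  simp

/-- The `H`-valued measure `s ↦ E(s) ψ`. -/
def vectorMeasure (ψ : H) : VectorMeasure ℝ H where
  measureOf' s := E.proj s ψ
  empty' := by simp [E.proj_empty]
  not_measurable' s hs := by simp [E.not_measurable s hs]
  m_iUnion' s hs hd := E.hasSum_iUnion s hs hd ψ

theorem proj_union {s t : Set ℝ} (hs : MeasurableSet s) (ht : MeasurableSet t)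
    (h : Disjoint s t) : E.proj (s ∪ t) = E.proj s + E.proj t := by
  ext ψ
  exact (E.vectorMeasure ψ).of_union h hs ht

theorem norm_proj_le {s : Set ℝ} (hs : MeasurableSet s) (ψ : H) : ‖E.proj s ψ‖ ≤ ‖ψ‖ := by
  have h := measure_mono (μ := E.measure ψ) (subset_univ s)
  rw [E.measure_univ_eq, E.measure_apply_enorm hs] at h
  have h' := (ENNReal.pow_le_pow_left_iff two_ne_zero).1 h
  exact enorm_le_iff_norm_le.1 h'

/-- On a vector in the range of `E(t)` the set `t` already carries the full mass, so additivity of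
the scalar measure leaves nothing for `s`. -/
theorem proj_disjoint {s t : Set ℝ} (hs : MeasurableSet s) (ht : MeasurableSet t)
    (h : Disjoint s t) : E.proj s * E.proj t = 0 := by
  ext φ
  set ψ := E.proj t φ with hψ
  have h1 : E.measure ψ (s ∪ t) = E.measure ψ s + E.measure ψ t := measure_union h ht
  have h2 : E.proj t ψ = ψ := E.proj_proj ht φ
  rw [E.measure_apply (hs.union ht), E.measure_apply hs, E.measure_apply ht, h2,
    ← ENNReal.ofReal_add (by positivity) (by positivity),
    ENNReal.ofReal_eq_ofReal_iff (by positivity) (by positivity)] at h1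
  have h3 := pow_le_pow_left₀ (norm_nonneg _) (E.norm_proj_le (hs.union ht) ψ) 2
  have h4 : ‖E.proj s ψ‖ ^ 2 = 0 := le_antisymm (by linarith) (by positivity)
  simpa using h4

theorem proj_mul_proj {s t : Set ℝ} (hs : MeasurableSet s) (ht : MeasurableSet t) :
    E.proj s * E.proj t = E.proj (s ∩ t) := by
  have h1 := E.proj_union (hs.inter ht) (hs.diff ht) (disjoint_sdiff_inter.symm)
  have h2 := E.proj_union (ht.inter hs) (ht.diff hs) (disjoint_sdiff_inter.symm)
  rw [inter_union_sdiff] at h1 h2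
  rw [h1, h2, inter_comm t s, add_mul, mul_add, mul_add,
    E.proj_disjoint (hs.inter ht) (ht.diff hs)
      (disjoint_left.2 fun x hx hx' => hx'.2 hx.1),
    E.proj_disjoint (hs.diff ht) (hs.inter ht)
      (disjoint_left.2 fun x hx hx' => hx.2 hx'.2),
    E.proj_disjoint (hs.diff ht) (ht.diff hs)
      (disjoint_left.2 fun x hx hx' => hx.2 hx'.1),
    (E.isStarProjection _ (hs.inter ht)).isIdempotentElem.eq]
  simp

/-! ### Integrals of simple functions -/

/-- `∫ g dE` for a simple function `g`. -/
def simple (g : SimpleFunc ℝ ℝ) : H →L[ℂ] H :=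
  g.setToSimpleFunc fun s => (ContinuousLinearMap.id ℝ ℝ).smulRight (E.proj s)

/-- The reference measure `0` makes every finiteness side condition vacuous, so the general algebra
of `setToSimpleFunc` applies to all simple functions. -/
theorem finMeasAdditive_proj : FinMeasAdditive (0 : Measure ℝ)
    fun s => (ContinuousLinearMap.id ℝ ℝ).smulRight (E.proj s) := by
  intro s t hs ht _ _ h
  ext
  simp [E.proj_union hs ht h]

theorem simple_add (f g : SimpleFunc ℝ ℝ) : E.simple (f + g) = E.simple f + E.simple g :=
  SimpleFunc.setToSimpleFunc_add _ E.finMeasAdditive_proj (by simp) (by simp)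

theorem simple_sub (f g : SimpleFunc ℝ ℝ) : E.simple (f - g) = E.simple f - E.simple g :=
  SimpleFunc.setToSimpleFunc_sub _ E.finMeasAdditive_proj (by simp) (by simp)

theorem simple_smul (c : ℝ) (f : SimpleFunc ℝ ℝ) : E.simple (c • f) = c • E.simple f :=
  SimpleFunc.setToSimpleFunc_smul_real _ E.finMeasAdditive_proj c (by simp)

theorem simple_indicator (c : ℝ) {s : Set ℝ} (hs : MeasurableSet s) :
    E.simple (SimpleFunc.piecewise s hs (SimpleFunc.const _ c) (SimpleFunc.const _ 0)) =
      c • E.proj s := by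
  rw [simple, SimpleFunc.setToSimpleFunc_indicator _ (by simp [E.proj_empty])]
  simp

theorem simple_mul (f g : SimpleFunc ℝ ℝ) : E.simple f * E.simple g = E.simple (f * g) := by
  induction f using SimpleFunc.induction with
  | add _ h₁ h₂ => rw [E.simple_add, add_mul, h₁, h₂, add_mul, E.simple_add]
  | const c hs =>
    rename_i s
    induction g using SimpleFunc.induction with
    | add _ h₁ h₂ => rw [E.simple_add, mul_add, h₁, h₂, mul_add, E.simple_add]
    | const d ht =>
      rename_i t
      have : SimpleFunc.piecewise s hs (SimpleFunc.const _ c) (SimpleFunc.const _ 0) *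
          SimpleFunc.piecewise t ht (SimpleFunc.const _ d) (SimpleFunc.const _ 0) =
          SimpleFunc.piecewise (s ∩ t) (hs.inter ht) (SimpleFunc.const _ (c * d))
            (SimpleFunc.const _ 0) := by
        ext x
        by_cases h1 : x ∈ s <;> by_cases h2 : x ∈ t <;> simp [h1, h2]
      rw [this, E.simple_indicator, E.simple_indicator, E.simple_indicator,
        ← E.proj_mul_proj hs ht, smul_mul_smul_comm]

theorem integrable_simple (g : SimpleFunc ℝ ℝ) (μ : Measure ℝ) [IsFiniteMeasure μ] :
    Integrable g μ := SimpleFunc.integrable_of_isFiniteMeasure g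

theorem inner_simple_self (g : SimpleFunc ℝ ℝ) (ψ : H) :
    inner ℂ ψ (E.simple g ψ) = ((∫ x, g x ∂(E.measure ψ) : ℝ) : ℂ) := by
  induction g using SimpleFunc.induction with
  | add _ h₁ h₂ =>
    rw [E.simple_add, add_apply, inner_add_right, h₁, h₂,
      SimpleFunc.coe_add]
    simp_rw [Pi.add_apply]
    rw [integral_add (integrable_simple _ _) (integrable_simple _ _)]
    push_cast; rfl
  | const c hs =>
    rename_i s
    have h : ∫ x, (SimpleFunc.piecewise s hs (SimpleFunc.const _ c) (SimpleFunc.const _ 0)) x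
        ∂(E.measure ψ) = c * ‖E.proj s ψ‖ ^ 2 := by
      rw [SimpleFunc.coe_piecewise, SimpleFunc.coe_const, SimpleFunc.coe_const]
      change ∫ x, s.indicator (fun _ => c) x ∂(E.measure ψ) = _
      rw [integral_indicator_const c hs, Measure.real, E.measure_apply hs,
        ENNReal.toReal_ofReal (by positivity), smul_eq_mul, mul_comm]
    rw [h, E.simple_indicator, smul_apply, ← Complex.coe_smul, inner_smul_right,
      E.inner_proj_self hs]
    push_cast; rfl

theorem inner_simple_left (g : SimpleFunc ℝ ℝ) (φ ψ : H) :
    inner ℂ (E.simple g φ) ψ = inner ℂ φ (E.simple g ψ) := by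
  induction g using SimpleFunc.induction with
  | add _ h₁ h₂ =>
    simp only [E.simple_add, add_apply, inner_add_right, inner_add_left, h₁, h₂]
  | const c hs =>
    rw [E.simple_indicator, smul_apply, smul_apply,
      ← Complex.coe_smul, ← Complex.coe_smul, inner_smul_left, inner_smul_right,
      E.inner_proj_left hs, Complex.conj_ofReal]

/-- Symmetry and multiplicativity move both factors onto one side as `g²`. This isometry is what
allows the extension from simple functions to `L²(μ_ψ)`. -/
theorem norm_simple_sq (g : SimpleFunc ℝ ℝ) (ψ : H) :
    ‖E.simple g ψ‖ ^ 2 = ∫ x, g x ^ 2 ∂(E.measure ψ) := by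
  have h : inner ℂ (E.simple g ψ) (E.simple g ψ) = ((∫ x, g x ^ 2 ∂(E.measure ψ) : ℝ) : ℂ) := by
    rw [E.inner_simple_left, ← mul_apply_eq_comp, E.simple_mul, E.inner_simple_self]
    simp [sq]
  rw [inner_self_eq_norm_sq_to_K] at h
  exact Complex.ofReal_injective (by simpa using h)

theorem eLpNorm_two_sq (f : ℝ → ℝ) (μ : Measure ℝ) :
    eLpNorm f 2 μ ^ 2 = ∫⁻ x, ENNReal.ofReal (f x ^ 2) ∂μ := by
  rw [eLpNorm_eq_lintegral_rpow_enorm_toReal two_ne_zero ENNReal.ofNat_ne_top]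
  rw [← ENNReal.rpow_natCast, ← ENNReal.rpow_mul]
  simp only [ENNReal.toReal_ofNat, Nat.cast_ofNat, one_div, ne_eq, OfNat.ofNat_ne_zero,
    not_false_eq_true, inv_mul_cancel₀, ENNReal.rpow_one]
  refine lintegral_congr fun x => ?_
  rw [← sq_abs, ENNReal.ofReal_pow (abs_nonneg _), ← Real.norm_eq_abs, ofReal_norm]
  exact ENNReal.rpow_natCast _ 2

theorem eLpNorm_two_ne_top_iff (f : ℝ → ℝ) (μ : Measure ℝ) :
    eLpNorm f 2 μ < ⊤ ↔ ∫⁻ x, ENNReal.ofReal (f x ^ 2) ∂μ < ⊤ := by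
  rw [← eLpNorm_two_sq, ENNReal.pow_lt_top_iff]
  simp

theorem enorm_simple (g : SimpleFunc ℝ ℝ) (ψ : H) :
    ‖E.simple g ψ‖ₑ = eLpNorm g 2 (E.measure ψ) := by
  suffices h : ‖E.simple g ψ‖ₑ ^ 2 = eLpNorm g 2 (E.measure ψ) ^ 2 from
    le_antisymm ((ENNReal.pow_le_pow_left_iff two_ne_zero).1 h.le)
      ((ENNReal.pow_le_pow_left_iff two_ne_zero).1 h.ge)
  rw [eLpNorm_two_sq, ← ofReal_norm, ← ENNReal.ofReal_pow (norm_nonneg _),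
    E.norm_simple_sq, ofReal_integral_eq_lintegral_ofReal]
  · exact (g.memLp_of_isFiniteMeasure 2 (E.measure ψ)).integrable_sq
  · exact ae_of_all _ fun x => sq_nonneg _

end SpectralResolution


namespace SpectralResolution

variable (E : SpectralResolution H)

/-! ### Integrals of square-integrable functions -/

theorem exists_simple_seq {f : ℝ → ℝ} {ν : Measure ℝ} (hf : MemLp f 2 ν) :
    ∃ g : ℕ → SimpleFunc ℝ ℝ, Tendsto (fun n => eLpNorm (f - ⇑(g n)) 2 ν) atTop (𝓝 0) := by
  have h : ∀ n : ℕ, ∃ g : SimpleFunc ℝ ℝ, eLpNorm (f - ⇑g) 2 ν < ((n : ℝ≥0∞) + 1)⁻¹ := fun n => by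
    obtain ⟨g, hg, -⟩ := hf.exists_simpleFunc_eLpNorm_sub_lt (ε := ((n : ℝ≥0∞) + 1)⁻¹)
      ENNReal.ofNat_ne_top (by simp)
    exact ⟨g, hg⟩
  choose g hg using h
  refine ⟨g, tendsto_of_tendsto_of_tendsto_of_le_of_le tendsto_const_nhds ?_ (fun _ => zero_le)
    fun n => (hg n).le⟩
  have := (tendsto_add_atTop_iff_nat 1).2 ENNReal.tendsto_inv_nat_nhds_zero
  simpa using this

theorem tendsto_eLpNorm_mono {f : ℝ → ℝ} {μ ν : Measure ℝ} (h : μ ≤ ν)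
    {g : ℕ → SimpleFunc ℝ ℝ} (hg : Tendsto (fun n => eLpNorm (f - ⇑(g n)) 2 ν) atTop (𝓝 0)) :
    Tendsto (fun n => eLpNorm (f - ⇑(g n)) 2 μ) atTop (𝓝 0) :=
  tendsto_of_tendsto_of_tendsto_of_le_of_le tendsto_const_nhds hg (fun _ => zero_le)
    fun _ => eLpNorm_mono_measure _ h

theorem memLp_add_measure {f : ℝ → ℝ} {μ ν : Measure ℝ} (hμ : MemLp f 2 μ) (hν : MemLp f 2 ν) :
    MemLp f 2 (μ + ν) := by
  refine ⟨aestronglyMeasurable_add_measure_iff.2 ⟨hμ.1, hν.1⟩, ?_⟩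
  rw [eLpNorm_two_ne_top_iff, lintegral_add_measure, ENNReal.add_lt_top,
    ← eLpNorm_two_ne_top_iff, ← eLpNorm_two_ne_top_iff]
  exact ⟨hμ.2, hν.2⟩

theorem simple_sub_apply (f g : SimpleFunc ℝ ℝ) (ψ : H) :
    E.simple (f - g) ψ = E.simple f ψ - E.simple g ψ := by
  rw [E.simple_sub]; rfl

/-- The isometry turns an approximating sequence into a Cauchy sequence. Recording the distance of
the limit to every simple function makes the limit independent of the chosen sequence. -/
theorem exists_int {f : ℝ → ℝ} {ψ : H} (hf : MemLp f 2 (E.measure ψ)) :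
    ∃ η : H, ∀ g : SimpleFunc ℝ ℝ, ‖η - E.simple g ψ‖ₑ = eLpNorm (f - ⇑g) 2 (E.measure ψ) := by
  obtain ⟨g, hg⟩ := exists_simple_seq hf
  have hm : ∀ k : SimpleFunc ℝ ℝ, AEStronglyMeasurable k (E.measure ψ) := fun k =>
    k.aestronglyMeasurable
  have h1 : ∀ n (k : SimpleFunc ℝ ℝ), ‖E.simple (g n) ψ - E.simple k ψ‖ₑ ≤
      eLpNorm (f - ⇑k) 2 (E.measure ψ) + eLpNorm (f - ⇑(g n)) 2 (E.measure ψ) := fun n k => by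
    rw [← E.simple_sub_apply, E.enorm_simple]
    have h2 : (⇑(g n - k) : ℝ → ℝ) = (f - ⇑k) - (f - ⇑(g n)) := by ext x; simp
    rw [h2]
    exact eLpNorm_sub_le (hf.1.sub (hm _)) (hf.1.sub (hm _)) (by norm_num)
  have h2 : ∀ n (k : SimpleFunc ℝ ℝ), eLpNorm (f - ⇑k) 2 (E.measure ψ) ≤
      ‖E.simple (g n) ψ - E.simple k ψ‖ₑ + eLpNorm (f - ⇑(g n)) 2 (E.measure ψ) := fun n k => by
    rw [← E.simple_sub_apply, E.enorm_simple]
    have h2 : f - ⇑k = ⇑(g n - k) + (f - ⇑(g n)) := by ext x; simp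
    rw [h2]
    exact eLpNorm_add_le (hm _) (hf.1.sub (hm _)) one_le_two
  have hc : CauchySeq fun n => E.simple (g n) ψ := by
    rw [EMetric.cauchySeq_iff]
    intro ε hε
    have hε2 : 0 < ε / 2 := ENNReal.half_pos hε.ne'
    obtain ⟨N, hN⟩ := eventually_atTop.1 (hg.eventually (gt_mem_nhds hε2))
    refine ⟨N, fun m hm n hn => ?_⟩
    rw [edist_eq_enorm_sub]
    calc _ ≤ _ := h1 m (g n)
      _ < ε / 2 + ε / 2 := ENNReal.add_lt_add (hN n hn) (hN m hm)
      _ = ε := ENNReal.add_halves ε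
  obtain ⟨η, hη⟩ := cauchySeq_tendsto_of_complete hc
  refine ⟨η, fun k => ?_⟩
  have h3 : Tendsto (fun n => ‖E.simple (g n) ψ - E.simple k ψ‖ₑ) atTop
      (𝓝 ‖η - E.simple k ψ‖ₑ) := (hη.sub_const _).enorm
  refine le_antisymm ?_ ?_
  · refine le_of_tendsto_of_tendsto' h3 (a₂ := eLpNorm (f - ⇑k) 2 (E.measure ψ)) ?_ (h1 · k)
    simpa using tendsto_const_nhds.add hg
  · have h4 := h3.add hg
    rw [add_zero] at h4
    exact ge_of_tendsto' h4 (h2 · k)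

open Classical in
/-- The vector `∫ f dE ψ` (junk value unless `f` is square-integrable with respect to the
spectral measure of `ψ`). -/
def int (f : ℝ → ℝ) (ψ : H) : H :=
  if h : MemLp f 2 (E.measure ψ) then (E.exists_int h).choose else 0

variable {E}

theorem enorm_int_sub_simple {f : ℝ → ℝ} {ψ : H} (hf : MemLp f 2 (E.measure ψ))
    (g : SimpleFunc ℝ ℝ) : ‖E.int f ψ - E.simple g ψ‖ₑ = eLpNorm (f - ⇑g) 2 (E.measure ψ) := by
  rw [int, dif_pos hf]
  exact (E.exists_int hf).choose_spec g

theorem tendsto_simple_int {f : ℝ → ℝ} {ψ : H} (hf : MemLp f 2 (E.measure ψ))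
    {g : ℕ → SimpleFunc ℝ ℝ}
    (hg : Tendsto (fun n => eLpNorm (f - ⇑(g n)) 2 (E.measure ψ)) atTop (𝓝 0)) :
    Tendsto (fun n => E.simple (g n) ψ) atTop (𝓝 (E.int f ψ)) := by
  rw [tendsto_iff_edist_tendsto_0]
  simp_rw [edist_comm _ (E.int f ψ), edist_eq_enorm_sub, enorm_int_sub_simple hf]
  exact hg

theorem eq_int_of_tendsto {f : ℝ → ℝ} {ψ η : H} (hf : MemLp f 2 (E.measure ψ))
    {g : ℕ → SimpleFunc ℝ ℝ}
    (hg : Tendsto (fun n => eLpNorm (f - ⇑(g n)) 2 (E.measure ψ)) atTop (𝓝 0))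
    (h : Tendsto (fun n => E.simple (g n) ψ) atTop (𝓝 η)) : E.int f ψ = η :=
  tendsto_nhds_unique (tendsto_simple_int hf hg) h

theorem memLp_simple (g : SimpleFunc ℝ ℝ) (ψ : H) : MemLp g 2 (E.measure ψ) :=
  g.memLp_of_isFiniteMeasure _ _

theorem int_simple (g : SimpleFunc ℝ ℝ) (ψ : H) : E.int g ψ = E.simple g ψ :=
  eq_int_of_tendsto (g := fun _ => g) (memLp_simple g ψ) (by simp) tendsto_const_nhds

theorem simple_zero : E.simple 0 = 0 := by
  have := E.simple_smul 0 0
  simpa using this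

theorem enorm_int {f : ℝ → ℝ} {ψ : H} (hf : MemLp f 2 (E.measure ψ)) :
    ‖E.int f ψ‖ₑ = eLpNorm f 2 (E.measure ψ) := by
  simpa [simple_zero] using enorm_int_sub_simple hf 0

theorem int_add {f h : ℝ → ℝ} {ψ : H} (hf : MemLp f 2 (E.measure ψ))
    (hh : MemLp h 2 (E.measure ψ)) : E.int (f + h) ψ = E.int f ψ + E.int h ψ := by
  obtain ⟨g, hg⟩ := exists_simple_seq hf
  obtain ⟨k, hk⟩ := exists_simple_seq hh
  refine eq_int_of_tendsto (g := fun n => g n + k n) (hf.add hh) ?_ ?_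
  · refine tendsto_of_tendsto_of_tendsto_of_le_of_le tendsto_const_nhds
      (by simpa using hg.add hk) (fun _ => zero_le) fun n => ?_
    have : f + h - ⇑(g n + k n) = (f - ⇑(g n)) + (h - ⇑(k n)) := by ext x; simp; ring
    dsimp only
    rw [this]
    exact eLpNorm_add_le (hf.1.sub (g n).aestronglyMeasurable)
      (hh.1.sub (k n).aestronglyMeasurable) (by norm_num)
  · simp_rw [E.simple_add]
    exact (tendsto_simple_int hf hg).add (tendsto_simple_int hh hk)

theorem int_smul {f : ℝ → ℝ} {ψ : H} (c : ℝ) (hf : MemLp f 2 (E.measure ψ)) :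
    E.int (c • f) ψ = (c : ℂ) • E.int f ψ := by
  obtain ⟨g, hg⟩ := exists_simple_seq hf
  refine eq_int_of_tendsto (g := fun n => c • g n) (hf.const_smul c) ?_ ?_
  · have h : ∀ n, eLpNorm (c • f - ⇑(c • g n)) 2 (E.measure ψ) =
        ‖c‖ₑ * eLpNorm (f - ⇑(g n)) 2 (E.measure ψ) := fun n => by
      rw [← eLpNorm_const_smul, smul_sub]; rfl
    simp_rw [h]
    simpa using ENNReal.Tendsto.const_mul hg (Or.inr (by simp : ‖c‖ₑ ≠ ⊤))
  · simp_rw [E.simple_smul, Complex.coe_smul]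
    exact (tendsto_simple_int hf hg).const_smul c

theorem int_sub {f h : ℝ → ℝ} {ψ : H} (hf : MemLp f 2 (E.measure ψ))
    (hh : MemLp h 2 (E.measure ψ)) : E.int (f - h) ψ = E.int f ψ - E.int h ψ := by
  have h1 : f - h = f + (-1 : ℝ) • h := by ext x; simp; ring
  rw [h1, int_add hf (hh.const_smul _), int_smul _ hh]
  simp [sub_eq_add_neg]

theorem int_congr {f h : ℝ → ℝ} {ψ : H} (hfh : f =ᵐ[E.measure ψ] h) :
    E.int f ψ = E.int h ψ := by
  by_cases hf : MemLp f 2 (E.measure ψ)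
  · have hh : MemLp h 2 (E.measure ψ) := (memLp_congr_ae hfh).1 hf
    rw [← sub_eq_zero, ← enorm_eq_zero, ← int_sub hf hh, enorm_int (hf.sub hh)]
    exact eLpNorm_eq_zero_of_ae_zero (by filter_upwards [hfh] with x hx; simp [hx])
  · have hh : ¬ MemLp h 2 (E.measure ψ) := fun hh => hf ((memLp_congr_ae hfh).2 hh)
    rw [int, int, dif_neg hf, dif_neg hh]

/-- Parallelogram law, with the difference term dropped; it makes the domain of `∫ f dE` closed
under addition. -/
theorem measure_add_le (ψ φ : H) :
    E.measure (ψ + φ) ≤ (2 : ℝ≥0∞) • (E.measure ψ + E.measure φ) := by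
  refine Measure.le_iff.2 fun s hs => ?_
  simp only [Measure.smul_apply, Measure.add_apply, smul_eq_mul, E.measure_apply hs, map_add]
  rw [← ENNReal.ofReal_add (by positivity) (by positivity),
    ← ENNReal.ofReal_ofNat 2, ← ENNReal.ofReal_mul (by norm_num)]
  refine ENNReal.ofReal_le_ofReal ?_
  have := parallelogram_law_with_norm ℂ (E.proj s ψ) (E.proj s φ)
  nlinarith [norm_nonneg (E.proj s ψ - E.proj s φ)]

theorem measure_smul (c : ℂ) (ψ : H) :
    E.measure (c • ψ) = ‖c‖ₑ ^ 2 • E.measure ψ := by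
  ext s hs
  simp [E.measure_apply_enorm hs, enorm_smul, mul_pow]

theorem memLp_vec_add {f : ℝ → ℝ} {ψ φ : H} (hψ : MemLp f 2 (E.measure ψ))
    (hφ : MemLp f 2 (E.measure φ)) : MemLp f 2 (E.measure (ψ + φ)) :=
  ((memLp_add_measure hψ hφ).smul_measure ENNReal.ofNat_ne_top).mono_measure (measure_add_le ψ φ)

theorem memLp_vec_smul {f : ℝ → ℝ} {ψ : H} (c : ℂ) (hψ : MemLp f 2 (E.measure ψ)) :
    MemLp f 2 (E.measure (c • ψ)) := by
  rw [measure_smul]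
  exact hψ.smul_measure (by simp)

theorem int_vec_add {f : ℝ → ℝ} {ψ φ : H} (hψ : MemLp f 2 (E.measure ψ))
    (hφ : MemLp f 2 (E.measure φ)) : E.int f (ψ + φ) = E.int f ψ + E.int f φ := by
  -- One sequence must approximate `f` for three spectral measures simultaneously, hence the sum of
  -- the measures.
  obtain ⟨g, hg⟩ := exists_simple_seq (memLp_add_measure (memLp_add_measure hψ hφ) (memLp_vec_add hψ hφ))
  have h1 : E.measure ψ ≤ E.measure ψ + E.measure φ + E.measure (ψ + φ) :=
    (Measure.le_add_right le_rfl).trans (Measure.le_add_right le_rfl)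
  have h2 : E.measure φ ≤ E.measure ψ + E.measure φ + E.measure (ψ + φ) :=
    (Measure.le_add_left le_rfl).trans (Measure.le_add_right le_rfl)
  have h3 : E.measure (ψ + φ) ≤ E.measure ψ + E.measure φ + E.measure (ψ + φ) :=
    Measure.le_add_left le_rfl
  refine eq_int_of_tendsto (memLp_vec_add hψ hφ) (tendsto_eLpNorm_mono h3 hg) ?_
  simp_rw [map_add]
  exact (tendsto_simple_int hψ (tendsto_eLpNorm_mono h1 hg)).add
    (tendsto_simple_int hφ (tendsto_eLpNorm_mono h2 hg))

theorem int_vec_smul {f : ℝ → ℝ} {ψ : H} (c : ℂ) (hψ : MemLp f 2 (E.measure ψ)) :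
    E.int f (c • ψ) = c • E.int f ψ := by
  obtain ⟨g, hg⟩ := exists_simple_seq (memLp_add_measure hψ (memLp_vec_smul c hψ))
  refine eq_int_of_tendsto (memLp_vec_smul c hψ)
    (tendsto_eLpNorm_mono (Measure.le_add_left le_rfl) hg) ?_
  simp_rw [map_smul]
  exact (tendsto_simple_int hψ
    (tendsto_eLpNorm_mono (Measure.le_add_right le_rfl) hg)).const_smul c

theorem inner_int_left {f : ℝ → ℝ} {ψ φ : H} (hψ : MemLp f 2 (E.measure ψ))
    (hφ : MemLp f 2 (E.measure φ)) : inner ℂ (E.int f φ) ψ = inner ℂ φ (E.int f ψ) := by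
  obtain ⟨g, hg⟩ := exists_simple_seq (memLp_add_measure hψ hφ)
  have h1 := tendsto_simple_int hψ (tendsto_eLpNorm_mono (Measure.le_add_right le_rfl) hg)
  have h2 := tendsto_simple_int hφ (tendsto_eLpNorm_mono (Measure.le_add_left le_rfl) hg)
  refine tendsto_nhds_unique (h2.inner (𝕜 := ℂ) tendsto_const_nhds) ?_
  simp_rw [E.inner_simple_left]
  exact tendsto_const_nhds.inner h1

theorem simple_one : E.simple (SimpleFunc.const ℝ 1) = 1 := by
  have h := E.simple_indicator 1 MeasurableSet.univ
  rw [E.proj_univ, SimpleFunc.piecewise_univ, one_smul] at h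
  exact h

theorem int_one (ψ : H) : E.int 1 ψ = ψ := by
  have h := int_simple (E := E) (SimpleFunc.const ℝ 1) ψ
  rw [simple_one] at h
  exact h

theorem memLp_one (ψ : H) : MemLp (1 : ℝ → ℝ) 2 (E.measure ψ) :=
  memLp_const 1

theorem norm_int_sq {f : ℝ → ℝ} {ψ : H} (hf : MemLp f 2 (E.measure ψ)) :
    ‖E.int f ψ‖ ^ 2 = ∫ x, f x ^ 2 ∂(E.measure ψ) := by
  have h : ‖E.int f ψ‖ₑ ^ 2 = ∫⁻ x, ENNReal.ofReal (f x ^ 2) ∂(E.measure ψ) := by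
    rw [enorm_int hf, eLpNorm_two_sq]
  rw [← ofReal_integral_eq_lintegral_ofReal hf.integrable_sq (ae_of_all _ fun x => sq_nonneg _),
    ← ofReal_norm, ← ENNReal.ofReal_pow (norm_nonneg _),
    ENNReal.ofReal_eq_ofReal_iff (by positivity) (integral_nonneg fun x => sq_nonneg _)] at h
  exact h

theorem inner_int_self {f : ℝ → ℝ} {ψ : H} (hf : MemLp f 2 (E.measure ψ)) :
    inner ℂ ψ (E.int f ψ) = ((∫ x, f x ∂(E.measure ψ) : ℝ) : ℂ) := by
  have him : (inner ℂ ψ (E.int f ψ)).im = 0 := by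
    have h := inner_int_left hf hf
    rw [← inner_conj_symm] at h
    exact Complex.conj_eq_iff_im.1 h
  -- Expanding `‖∫ (1 + f) dE ψ‖²` and using the isometry for `1`, `f` and `1 + f` isolates the
  -- cross term.
  have hre : (inner ℂ ψ (E.int f ψ)).re = ∫ x, f x ∂(E.measure ψ) := by
    have h1 := norm_int_sq ((memLp_one (E := E) ψ).add hf)
    have hint : Integrable f (E.measure ψ) := hf.integrable (by norm_num)
    rw [int_add (memLp_one ψ) hf, int_one, norm_add_sq (𝕜 := ℂ), norm_int_sq hf] at h1
    have h2 := norm_int_sq (memLp_one (E := E) ψ)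
    rw [int_one] at h2
    have h3 : ∫ x, (1 + f) x ^ 2 ∂(E.measure ψ) = ∫ x, (1 : ℝ → ℝ) x ^ 2 ∂(E.measure ψ) +
        2 * ∫ x, f x ∂(E.measure ψ) + ∫ x, f x ^ 2 ∂(E.measure ψ) := by
      rw [← integral_const_mul, ← integral_add, ← integral_add]
      · congr 1; ext x; simp only [Pi.add_apply, Pi.one_apply]; ring
      · exact (memLp_one ψ).integrable_sq.add (hint.const_mul 2)
      · exact hf.integrable_sq
      · exact (memLp_one ψ).integrable_sq
      · exact hint.const_mul 2
    rw [h3, h2] at h1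
    simp only [RCLike.re_to_complex] at h1
    linarith
  exact Complex.ext (by simpa using hre) (by simpa using him)

/-! ### Multiplicativity -/

theorem memLp_simple_mul {f : ℝ → ℝ} {ν : Measure ℝ} (k : SimpleFunc ℝ ℝ) (hf : MemLp f 2 ν) :
    MemLp (⇑k * f) 2 ν := by
  obtain ⟨C, hC⟩ := k.exists_forall_norm_le
  refine hf.of_le_mul (c := C) (k.aestronglyMeasurable.mul hf.1) (ae_of_all _ fun x => ?_)
  rw [Pi.mul_apply, norm_mul]
  exact mul_le_mul_of_nonneg_right (hC x) (norm_nonneg _)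

theorem simple_int {f : ℝ → ℝ} {ψ : H} (k : SimpleFunc ℝ ℝ) (hf : MemLp f 2 (E.measure ψ)) :
    E.simple k (E.int f ψ) = E.int (⇑k * f) ψ := by
  obtain ⟨g, hg⟩ := exists_simple_seq hf
  obtain ⟨C, hC⟩ := k.exists_forall_norm_le
  refine (eq_int_of_tendsto (g := fun n => k * g n) (memLp_simple_mul k hf) ?_ ?_).symm
  · have h0 : Tendsto (fun n => ENNReal.ofReal C * eLpNorm (f - ⇑(g n)) 2 (E.measure ψ)) atTop
        (𝓝 0) := by simpa using ENNReal.Tendsto.const_mul hg (Or.inr ENNReal.ofReal_ne_top)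
    refine tendsto_of_tendsto_of_tendsto_of_le_of_le tendsto_const_nhds h0 (fun _ => zero_le)
      fun n => eLpNorm_le_mul_eLpNorm_of_ae_le_mul (ae_of_all _ fun x => ?_) 2
    rw [SimpleFunc.coe_mul, ← mul_sub, Pi.mul_apply, norm_mul]
    exact mul_le_mul_of_nonneg_right (hC x) (norm_nonneg _)
  · simp_rw [← E.simple_mul]
    exact ((E.simple k).continuous.tendsto _).comp (tendsto_simple_int hf hg)

/-- Applying `E(s)` multiplies the integrand by the indicator of `s`, and the isometry computes the
norm of the result. -/
theorem measure_int {f : ℝ → ℝ} {ψ : H} (hf : MemLp f 2 (E.measure ψ)) :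
    E.measure (E.int f ψ) = (E.measure ψ).withDensity fun x => ENNReal.ofReal (f x ^ 2) := by
  ext s hs
  have h1 := E.simple_indicator 1 hs
  rw [one_smul] at h1
  rw [E.measure_apply_enorm hs, withDensity_apply _ hs, ← h1, simple_int _ hf,
    enorm_int (memLp_simple_mul _ hf), eLpNorm_two_sq, ← lintegral_indicator hs]
  refine lintegral_congr fun x => ?_
  by_cases hx : x ∈ s <;> simp [hx]

theorem eLpNorm_int {f g : ℝ → ℝ} {ψ : H} (hf : MemLp f 2 (E.measure ψ)) (hfm : Measurable f)
    (hg : Measurable g) :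
    eLpNorm g 2 (E.measure (E.int f ψ)) = eLpNorm (g * f) 2 (E.measure ψ) := by
  have h : eLpNorm g 2 (E.measure (E.int f ψ)) ^ 2 = eLpNorm (g * f) 2 (E.measure ψ) ^ 2 := by
    rw [eLpNorm_two_sq, eLpNorm_two_sq, measure_int hf,
      lintegral_withDensity_eq_lintegral_mul _ (by fun_prop) (by fun_prop)]
    refine lintegral_congr fun x => ?_
    simp only [Pi.mul_apply]
    rw [← ENNReal.ofReal_mul (sq_nonneg _), mul_pow, mul_comm]
  exact le_antisymm ((ENNReal.pow_le_pow_left_iff two_ne_zero).1 h.le)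
      ((ENNReal.pow_le_pow_left_iff two_ne_zero).1 h.ge)

theorem memLp_int_iff {f g : ℝ → ℝ} {ψ : H} (hf : MemLp f 2 (E.measure ψ)) (hfm : Measurable f)
    (hg : Measurable g) :
    MemLp g 2 (E.measure (E.int f ψ)) ↔ MemLp (g * f) 2 (E.measure ψ) := by
  simp only [MemLp, eLpNorm_int hf hfm hg, hg.aestronglyMeasurable,
    (hg.mul hfm).aestronglyMeasurable]

theorem int_int {f g : ℝ → ℝ} {ψ : H} (hf : MemLp f 2 (E.measure ψ)) (hfm : Measurable f)
    (hg : Measurable g) (hgf : MemLp (g * f) 2 (E.measure ψ)) :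
    E.int g (E.int f ψ) = E.int (g * f) ψ := by
  have hg' := (memLp_int_iff hf hfm hg).2 hgf
  -- Approximating `g` in the weighted space `L²(f² μ_ψ)` is the same as approximating `g f` by `k
  -- f` in `L²(μ_ψ)`.
  obtain ⟨k, hk⟩ := exists_simple_seq hg'
  refine eq_int_of_tendsto hg' hk ?_
  simp_rw [simple_int _ hf]
  rw [tendsto_iff_edist_tendsto_0]
  simp_rw [edist_comm _ (E.int (g * f) ψ), edist_eq_enorm_sub]
  refine hk.congr fun n => ?_
  rw [← int_sub hgf (memLp_simple_mul _ hf), enorm_int (hgf.sub (memLp_simple_mul _ hf)),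
    eLpNorm_int hf hfm (hg.sub (k n).measurable), sub_mul]

end SpectralResolution


namespace SpectralResolution

variable {E : SpectralResolution H}

/-! ### The operator `∫ f dE` -/

theorem memLp_vec_zero (f : ℝ → ℝ) : MemLp f 2 (E.measure 0) := by
  have h : E.measure 0 = 0 := by
    have := measure_smul (E := E) 0 0
    simpa using this
  rw [h]
  exact memLp_measure_zero

variable (E) in
/-- The operator `∫ f dE` on the domain of all `ψ` such that `f` is square-integrable with respect
to the spectral measure of `ψ`. -/
def op (f : ℝ → ℝ) : H →ₗ.[ℂ] H where
  domain :=
    { carrier := {ψ | MemLp f 2 (E.measure ψ)}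
      zero_mem' := memLp_vec_zero f
      add_mem' := memLp_vec_add
      smul_mem' := fun c _ h => memLp_vec_smul c h }
  toFun :=
    { toFun := fun ψ => E.int f ψ
      map_add' := fun ψ φ => int_vec_add ψ.2 φ.2
      map_smul' := fun c ψ => int_vec_smul c ψ.2 }

theorem mem_op_domain {f : ℝ → ℝ} {ψ : H} : ψ ∈ (E.op f).domain ↔ MemLp f 2 (E.measure ψ) :=
  Iff.rfl

theorem memLp_two_iff {f : ℝ → ℝ} (hf : Measurable f) {μ : Measure ℝ} :
    MemLp f 2 μ ↔ ∫⁻ x, ENNReal.ofReal (f x ^ 2) ∂μ < ⊤ := by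
  rw [← eLpNorm_two_ne_top_iff, MemLp, and_iff_right hf.aestronglyMeasurable]

theorem isIntegral_op {f : ℝ → ℝ} (hf : Measurable f) : E.IsIntegral f (E.op f) :=
  ⟨fun _ => memLp_two_iff hf, fun ψ => inner_int_self ψ.2⟩

/-- Complex polarization with `φ + ψ` and `φ + iψ` kills all matrix elements between domain vectors;
density does the rest. -/
theorem linearMap_eq_zero_of_inner_self_eq_zero {D : Submodule ℂ H} (hD : Dense (D : Set H))
    (L : D →ₗ[ℂ] H) (h : ∀ ψ : D, inner ℂ (ψ : H) (L ψ) = 0) : L = 0 := by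
  ext ψ
  refine hD.eq_zero_of_inner_right (𝕜 := ℂ) fun φ hφ => ?_
  have h1 := h (⟨φ, hφ⟩ + ψ)
  have h2 := h (⟨φ, hφ⟩ + Complex.I • ψ)
  have h3 := h ψ
  have h4 := h ⟨φ, hφ⟩
  simp only [map_add, map_smul, Submodule.coe_add, Submodule.coe_smul, inner_add_left,
    inner_add_right, inner_smul_left, inner_smul_right, h3, h4, Complex.conj_I] at h1 h2
  have h5 : Complex.I * inner ℂ (ψ : H) (L ⟨φ, hφ⟩) = Complex.I * inner ℂ φ (L ψ) := by
    linear_combination -h2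
  have h6 := mul_left_cancel₀ Complex.I_ne_zero h5
  rw [h6] at h1
  have h7 : (2 : ℂ) * inner ℂ φ (L ψ) = 0 := by linear_combination h1
  simpa using h7

theorem memLp_of_bounded {f : ℝ → ℝ} (hf : Measurable f) (C : ℝ) (hC : ∀ x, |f x| ≤ C) (ψ : H) :
    MemLp f 2 (E.measure ψ) :=
  MemLp.of_bound hf.aestronglyMeasurable C (ae_of_all _ hC)

theorem abs_inv_one_add_sq_le (x : ℝ) : |(1 + x ^ 2)⁻¹| ≤ 1 := by
  rw [abs_inv, abs_of_pos (by positivity)]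
  exact inv_le_one_of_one_le₀ (by nlinarith)

theorem abs_div_one_add_sq_le (x : ℝ) : |x * (1 + x ^ 2)⁻¹| ≤ 1 := by
  rw [abs_mul, abs_inv, abs_of_pos (by positivity : 0 < 1 + x ^ 2), ← div_eq_mul_inv,
    div_le_one (by positivity)]
  nlinarith [sq_abs x, sq_nonneg (|x| - 1)]

theorem abs_sq_div_one_add_sq_le (x : ℝ) : |x * (x * (1 + x ^ 2)⁻¹)| ≤ 1 := by
  rw [← mul_assoc, abs_mul, abs_inv, abs_of_pos (by positivity : 0 < 1 + x ^ 2),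
    ← div_eq_mul_inv, div_le_one (by positivity), ← sq, abs_of_nonneg (sq_nonneg x)]
  linarith

section Regularization

variable {f : ℝ → ℝ} (hf : Measurable f) (ψ : H)
include hf

theorem memLp_inv_one_add_sq : MemLp (fun x => (1 + f x ^ 2)⁻¹) 2 (E.measure ψ) :=
  memLp_of_bounded (by fun_prop) 1 (fun x => abs_inv_one_add_sq_le (f x)) ψ

theorem memLp_div_one_add_sq : MemLp (fun x => f x * (1 + f x ^ 2)⁻¹) 2 (E.measure ψ) :=
  memLp_of_bounded (by fun_prop) 1 (fun x => abs_div_one_add_sq_le (f x)) ψ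

theorem memLp_sq_div_one_add_sq :
    MemLp (fun x => f x * (f x * (1 + f x ^ 2)⁻¹)) 2 (E.measure ψ) :=
  memLp_of_bounded (by fun_prop) 1 (fun x => abs_sq_div_one_add_sq_le (f x)) ψ

theorem memLp_int_inv_one_add_sq :
    MemLp f 2 (E.measure (E.int (fun x => (1 + f x ^ 2)⁻¹) ψ)) :=
  (memLp_int_iff (memLp_inv_one_add_sq hf ψ) (by fun_prop) hf).2 (memLp_div_one_add_sq hf ψ)

theorem int_int_inv_one_add_sq :
    E.int f (E.int (fun x => (1 + f x ^ 2)⁻¹) ψ) = E.int (fun x => f x * (1 + f x ^ 2)⁻¹) ψ :=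
  int_int (memLp_inv_one_add_sq hf ψ) (by fun_prop) hf (memLp_div_one_add_sq hf ψ)

theorem memLp_int_div_one_add_sq :
    MemLp f 2 (E.measure (E.int (fun x => f x * (1 + f x ^ 2)⁻¹) ψ)) :=
  (memLp_int_iff (memLp_div_one_add_sq hf ψ) (by fun_prop) hf).2 (memLp_sq_div_one_add_sq hf ψ)

/-- This is `(1+f²)⁻¹ + f · f(1+f²)⁻¹ = 1`. With `A = ∫ f dE`, the vectors `u = (1+A²)⁻¹ψ` and `z =
A(1+A²)⁻¹ψ` lie in the domain and satisfy `A u = z`, `u + A z = ψ`, a real-valued substitute for the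
resolvents at `±i`. -/
theorem int_inv_one_add_sq_add :
    E.int (fun x => (1 + f x ^ 2)⁻¹) ψ + E.int f (E.int (fun x => f x * (1 + f x ^ 2)⁻¹) ψ)
      = ψ := by
  rw [int_int (memLp_div_one_add_sq hf ψ) (by fun_prop) hf (memLp_sq_div_one_add_sq hf ψ),
    ← int_add (memLp_inv_one_add_sq hf ψ) (by exact memLp_sq_div_one_add_sq hf ψ)]
  convert int_one ψ using 2
  ext x
  have : 1 + f x ^ 2 ≠ 0 := by positivity
  simp only [Pi.add_apply, Pi.mul_apply, Pi.one_apply]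
  field_simp

end Regularization

/-- A vector `ψ` orthogonal to the domain is orthogonal to `(1+A²)⁻¹ψ`, so a strictly positive
function has integral zero against `μ_ψ`, forcing `ψ = 0`. -/
theorem dense_op_domain {f : ℝ → ℝ} (hf : Measurable f) : Dense ((E.op f).domain : Set H) := by
  rw [Submodule.dense_iff_topologicalClosure_eq_top, Submodule.topologicalClosure_eq_top_iff,
    Submodule.eq_bot_iff]
  intro ψ hψ
  have h1 := (Submodule.mem_orthogonal' _ _).1 hψ _
    (mem_op_domain.2 (memLp_int_inv_one_add_sq hf ψ))
  have hm := memLp_inv_one_add_sq (E := E) hf ψ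
  rw [inner_int_self hm] at h1
  have h2 : ∫ x, (1 + f x ^ 2)⁻¹ ∂(E.measure ψ) = 0 := by exact_mod_cast h1
  rw [integral_eq_zero_iff_of_nonneg (fun x => by positivity) (hm.integrable (by norm_num))] at h2
  have h3 : E.measure ψ = 0 := by
    rw [← ae_eq_bot, ← Filter.eventually_false_iff_eq_bot]
    filter_upwards [h2] with x hx
    have : (1 + f x ^ 2)⁻¹ ≠ 0 := by positivity
    exact this hx
  have h4 := E.measure_univ_eq ψ
  rw [h3] at h4
  simpa using h4.symm

theorem IsIntegral.eq_op {f : ℝ → ℝ} (hf : Measurable f) {A : H →ₗ.[ℂ] H}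
    (h : E.IsIntegral f A) : A = E.op f := by
  have hd : A.domain = (E.op f).domain := by
    ext ψ
    rw [h.1, mem_op_domain, memLp_two_iff hf]
  have h0 := linearMap_eq_zero_of_inner_self_eq_zero (D := (E.op f).domain) (dense_op_domain hf)
    (A.toFun ∘ₗ (Submodule.inclusion hd.ge) - (E.op f).toFun) (fun ψ => by
      have h1 := h.2 ⟨ψ, hd.ge ψ.2⟩
      have h2 := (isIntegral_op (E := E) hf).2 ψ
      rw [LinearMap.sub_apply, inner_sub_right, sub_eq_zero]
      exact h1.trans h2.symm)
  refine LinearPMap.ext hd fun x hx hx' => ?_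
  have h1 := LinearMap.congr_fun h0 ⟨x, hx'⟩
  rw [LinearMap.sub_apply, LinearMap.zero_apply, sub_eq_zero] at h1
  exact h1

theorem isSelfAdjoint_op {f : ℝ → ℝ} (hf : Measurable f) : IsSelfAdjoint (E.op f) := by
  have hd := dense_op_domain (E := E) hf
  rw [LinearPMap.isSelfAdjoint_def]
  have hle : E.op f ≤ (E.op f).adjoint :=
    LinearPMap.IsFormalAdjoint.le_adjoint hd fun x y => inner_int_left y.2 x.2
  refine (LinearPMap.eq_of_le_of_domain_eq hle (le_antisymm hle.1 fun φ hφ => ?_)).symm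
  set η := (E.op f).adjoint ⟨φ, hφ⟩ with hη
  have h1 : ∀ ψ, MemLp f 2 (E.measure ψ) → inner ℂ η ψ = inner ℂ φ (E.int f ψ) := fun ψ hψ =>
    LinearPMap.adjoint_isFormalAdjoint hd ⟨φ, hφ⟩ ⟨ψ, hψ⟩
  -- Testing against `ψ` and moving the bounded operators across displays `φ` as a sum of two
  -- regularized vectors, each of which lies in the domain.
  have h2 : E.int (fun x => (1 + f x ^ 2)⁻¹) φ + E.int (fun x => f x * (1 + f x ^ 2)⁻¹) η = φ := by
    refine ext_inner_right ℂ fun ψ => ?_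
    rw [inner_add_left, inner_int_left (memLp_inv_one_add_sq hf ψ) (memLp_inv_one_add_sq hf φ),
      inner_int_left (memLp_div_one_add_sq hf ψ) (memLp_div_one_add_sq hf η),
      h1 _ (memLp_int_div_one_add_sq hf ψ), ← inner_add_right, int_inv_one_add_sq_add hf]
  rw [← h2]
  exact memLp_vec_add (memLp_int_inv_one_add_sq hf φ) (memLp_int_div_one_add_sq hf η)

/-! ### Uniqueness of the resolution -/

variable {E' : SpectralResolution H}

theorem ext_of_measure (h : ∀ ψ, E.measure ψ = E'.measure ψ) : E = E' := by
  ext1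
  funext s
  by_cases hs : MeasurableSet s
  · have h1 : (E.proj s : H →ₗ[ℂ] H) = E'.proj s := by
      rw [← ext_inner_map]
      intro ψ
      have h2 := congrArg (fun μ : Measure ℝ => μ s) (h ψ)
      simp only [E.measure_apply hs, E'.measure_apply hs] at h2
      rw [ENNReal.ofReal_eq_ofReal_iff (by positivity) (by positivity)] at h2
      rw [ContinuousLinearMap.coe_coe, ContinuousLinearMap.coe_coe, E.inner_proj_left hs,
        E'.inner_proj_left hs, E.inner_proj_self hs, E'.inner_proj_self hs, h2]
    exact ContinuousLinearMap.coe_injective h1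
  · rw [E.not_measurable s hs, E'.not_measurable s hs]

/-- The differences satisfy `A δu = δz` and `A δz = -δu`, so symmetry gives `‖δz‖² = -‖δu‖²`. Hence
the operator alone determines the regularized vectors. -/
theorem eq_of_symmetric_of_add_sq {A : H →ₗ.[ℂ] H}
    (hA : ∀ x y : A.domain, inner ℂ (A x) (y : H) = inner ℂ (x : H) (A y)) {ψ : H}
    {u u' z z' : A.domain} (h₁ : A u = z) (h₂ : u + A z = ψ) (h₁' : A u' = z')
    (h₂' : u' + A z' = ψ) : u = u' ∧ z = z' := by
  have h1 : A (u - u') = z - z' := by rw [LinearPMap.map_sub, h₁, h₁']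
  have h2 : A (z - z') = -(u - u' : H) := by
    rw [LinearPMap.map_sub, eq_sub_of_add_eq' h₂, eq_sub_of_add_eq' h₂']
    abel
  have h3 := hA (u - u') (z - z')
  rw [h1, h2, Submodule.coe_sub, Submodule.coe_sub, inner_neg_right, inner_self_eq_norm_sq_to_K,
    inner_self_eq_norm_sq_to_K] at h3
  have h4 : ‖(z - z' : H)‖ ^ 2 = -‖(u - u' : H)‖ ^ 2 := Complex.ofReal_injective (by simpa using h3)
  have h5 : ‖(u - u' : H)‖ ^ 2 = 0 := by
    nlinarith [sq_nonneg ‖(z - z' : H)‖, sq_nonneg ‖(u - u' : H)‖]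
  have h6 : ‖(z - z' : H)‖ ^ 2 = 0 := by rw [h4, h5, neg_zero]
  exact ⟨Subtype.ext (sub_eq_zero.1 (by simpa using h5)),
    Subtype.ext (sub_eq_zero.1 (by simpa using h6))⟩

theorem int_regularization_eq {A : H →ₗ.[ℂ] H} (h : A = E.op fun x => x)
    (h' : A = E'.op fun x => x) (ψ : H) :
    E.int (fun x => (1 + x ^ 2)⁻¹) ψ = E'.int (fun x => (1 + x ^ 2)⁻¹) ψ ∧
    E.int (fun x => x * (1 + x ^ 2)⁻¹) ψ = E'.int (fun x => x * (1 + x ^ 2)⁻¹) ψ := by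
  have key : ∀ F : SpectralResolution H, A = F.op (fun x => x) → ∃ u z : A.domain,
      (u : H) = F.int (fun x => (1 + x ^ 2)⁻¹) ψ ∧ (z : H) = F.int (fun x => x * (1 + x ^ 2)⁻¹) ψ ∧
      A u = z ∧ u + A z = ψ := by
    rintro F rfl
    exact ⟨⟨_, memLp_int_inv_one_add_sq measurable_id ψ⟩,
      ⟨_, memLp_int_div_one_add_sq measurable_id ψ⟩, rfl, rfl,
      int_int_inv_one_add_sq measurable_id ψ, int_inv_one_add_sq_add measurable_id ψ⟩
  have hA : ∀ x y : A.domain, inner ℂ (A x) (y : H) = inner ℂ (x : H) (A y) := by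
    subst h
    exact fun x y => inner_int_left y.2 x.2
  obtain ⟨u, z, hu, hz, h1, h2⟩ := key E h
  obtain ⟨u', z', hu', hz', h1', h2'⟩ := key E' h'
  obtain ⟨h3, h4⟩ := eq_of_symmetric_of_add_sq hA h1 h2 h1' h2'
  rw [← hu, ← hz, ← hu', ← hz', h3, h4]
  exact ⟨rfl, rfl⟩

theorem memLp_bcf (g : BoundedContinuousFunction ℝ ℝ) (ψ : H) : MemLp g 2 (E.measure ψ) :=
  memLp_of_bounded g.continuous.measurable ‖g‖ g.norm_coe_le_norm ψ

theorem int_bcf_mul (g k : BoundedContinuousFunction ℝ ℝ) (ψ : H) :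
    E.int ⇑(g * k) ψ = E.int g (E.int k ψ) :=
  (int_int (memLp_bcf k ψ) k.continuous.measurable g.continuous.measurable
    (memLp_bcf (g * k) ψ)).symm

variable (E E') in
/-- The algebra of bounded continuous functions with the same integral with respect to two
resolutions. -/
def coincidence : StarSubalgebra ℝ (BoundedContinuousFunction ℝ ℝ) where
  carrier := {g | ∀ ψ, E.int g ψ = E'.int g ψ}
  mul_mem' {g k} hg hk ψ := by rw [int_bcf_mul, int_bcf_mul, hk, hg]
  add_mem' {g k} hg hk ψ := by
    rw [BoundedContinuousFunction.coe_add, int_add (memLp_bcf g ψ) (memLp_bcf k ψ),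
      int_add (memLp_bcf g ψ) (memLp_bcf k ψ), hg, hk]
  algebraMap_mem' c ψ := by
    have h : ⇑(algebraMap ℝ (BoundedContinuousFunction ℝ ℝ) c) = c • (1 : ℝ → ℝ) := by
      ext x; simp
    rw [h, int_smul c (memLp_one ψ), int_smul c (memLp_one ψ), int_one, int_one]
  star_mem' {g} hg ψ := hg ψ

/-- Finite measures on a Polish space are determined by a point-separating algebra of bounded
continuous functions; here the algebra where both resolutions have equal integrals. -/
theorem IsResolutionOf.unique {A : H →ₗ.[ℂ] H} (h : E.IsResolutionOf A)
    (h' : E'.IsResolutionOf A) : E = E' := by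
  have hA := IsIntegral.eq_op measurable_id h
  have hA' := IsIntegral.eq_op measurable_id h'
  refine ext_of_measure fun ψ => ?_
  refine ext_of_forall_mem_subalgebra_integral_eq_of_polish (𝕜 := ℝ) (A := coincidence E E')
    ?_ fun g hg => ?_
  · have hp : Continuous fun x : ℝ => (1 + x ^ 2)⁻¹ :=
      Continuous.inv₀ (by fun_prop) fun x => by positivity
    let p := BoundedContinuousFunction.ofNormedAddCommGroup _ hp 1 abs_inv_one_add_sq_le
    let q := BoundedContinuousFunction.ofNormedAddCommGroup (fun x : ℝ => x * (1 + x ^ 2)⁻¹)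
      (continuous_id.mul hp) 1 abs_div_one_add_sq_le
    have hpm : p ∈ coincidence E E' := fun ψ => (int_regularization_eq hA hA' ψ).1
    have hqm : q ∈ coincidence E E' := fun ψ => (int_regularization_eq hA hA' ψ).2
    intro x y hxy
    -- The first function separates points of different modulus; where it agrees, the second differs
    -- from the identity only by a common nonzero factor.
    by_cases hpx : (1 + x ^ 2)⁻¹ = (1 + y ^ 2)⁻¹
    · refine ⟨q, ⟨q.toContinuousMap, ⟨q, hqm, rfl⟩, rfl⟩, ?_⟩
      change x * (1 + x ^ 2)⁻¹ ≠ y * (1 + y ^ 2)⁻¹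
      rw [hpx]
      exact fun h => hxy (mul_right_cancel₀ (by positivity) h)
    · exact ⟨p, ⟨p.toContinuousMap, ⟨p, hpm, rfl⟩, rfl⟩, hpx⟩
  · have h1 := inner_int_self (memLp_bcf (E := E) g ψ)
    rw [hg ψ, inner_int_self (memLp_bcf g ψ)] at h1
    exact (Complex.ofReal_injective h1).symm

/-! ### Image of a resolution -/

open Classical in
variable (E) in
/-- The image of a resolution under a measurable function. -/
def map (f : ℝ → ℝ) (hf : Measurable f) : SpectralResolution H where
  proj s := if MeasurableSet s then E.proj (f ⁻¹' s) else 0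
  isStarProjection s hs := by
    rw [if_pos hs]
    exact E.isStarProjection _ (hf hs)
  not_measurable s hs := if_neg hs
  proj_univ := by rw [if_pos MeasurableSet.univ, preimage_univ, E.proj_univ]
  hasSum_iUnion s hs hd ψ := by
    simp only [hs, MeasurableSet.iUnion hs, if_true, preimage_iUnion]
    exact E.hasSum_iUnion _ (fun n => hf (hs n)) (fun i j hij => (hd hij).preimage f) ψ

theorem measure_map {f : ℝ → ℝ} (hf : Measurable f) (ψ : H) :
    (E.map f hf).measure ψ = (E.measure ψ).map f := by
  ext s hs
  rw [Measure.map_apply hf hs, measure_apply _ hs, E.measure_apply (hf hs)]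
  simp [map, hs]

theorem IsIntegral.isIntegral_map {f g : ℝ → ℝ} (hf : Measurable f) (hg : Measurable g)
    {A : H →ₗ.[ℂ] H} (h : E.IsIntegral (fun x => g (f x)) A) : (E.map f hf).IsIntegral g A := by
  refine ⟨fun ψ => ?_, fun ψ => ?_⟩
  · rw [h.1, measure_map, lintegral_map (by fun_prop) hf]
  · rw [h.2, measure_map, integral_map hf.aemeasurable hg.aestronglyMeasurable]

end SpectralResolution

/-! ### Values of the chosen resolution and functional calculus -/

open SpectralResolution

theorem SpectralResolution.IsResolutionOf.spectralResolution_eq {E : SpectralResolution H}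
    {A : H →ₗ.[ℂ] H} (h : E.IsResolutionOf A) : spectralResolution A = E := by
  have h' : ∃ E : SpectralResolution H, E.IsResolutionOf A := ⟨E, h⟩
  rw [spectralResolution, dif_pos h']
  exact h'.choose_spec.unique h

theorem functionalCalculus_eq {f : ℝ → ℝ} (hf : Measurable f) (A : H →ₗ.[ℂ] H) :
    functionalCalculus f A = (spectralResolution A).op f := by
  have h : ∃ B : H →ₗ.[ℂ] H, (spectralResolution A).IsIntegral f B := ⟨_, isIntegral_op hf⟩
  rw [functionalCalculus, dif_pos h]
  exact h.choose_spec.eq_op hf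

theorem isResolutionOf_functionalCalculus {f : ℝ → ℝ} (hf : Measurable f) (A : H →ₗ.[ℂ] H) :
    ((spectralResolution A).map f hf).IsResolutionOf (functionalCalculus f A) := by
  rw [functionalCalculus_eq hf]
  exact IsIntegral.isIntegral_map (g := fun x => x) hf measurable_id (isIntegral_op hf)


/-! ### Spectral theorem for bounded self-adjoint operators -/

/-- The hypothesis says that `P*P` and `P` have the same quadratic form. Then `P = P*P` is
self-adjoint, hence idempotent. -/
theorem isStarProjection_of_inner {P : H →L[ℂ] H}
    (h : ∀ ψ, inner ℂ ψ (P ψ) = ((‖P ψ‖ ^ 2 : ℝ) : ℂ)) : IsStarProjection P := by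
  have h1 : star P * P = P := by
    refine ContinuousLinearMap.coe_injective ((ext_inner_map _ _).1 fun ψ => ?_)
    rw [ContinuousLinearMap.coe_coe, ContinuousLinearMap.coe_coe, mul_apply_eq_comp,
      ContinuousLinearMap.star_eq_adjoint, ContinuousLinearMap.adjoint_inner_left,
      inner_self_eq_norm_sq_to_K, ← inner_conj_symm, h, Complex.conj_ofReal]
    simp
  have h2 : star P = P := by
    conv_lhs => rw [← h1, star_mul, star_star, h1]
  exact ⟨by rw [IsIdempotentElem]; nth_rewrite 1 [← h2]; exact h1, h2⟩

theorem _root_.IsStarProjection.inner_left {P : H →L[ℂ] H} (hP : IsStarProjection P) (φ ψ : H) :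
    inner ℂ (P φ) ψ = inner ℂ φ (P ψ) := by
  have h := ContinuousLinearMap.adjoint_inner_right P φ ψ
  rw [← ContinuousLinearMap.star_eq_adjoint, hP.isSelfAdjoint.star_eq] at h
  exact h.symm

theorem _root_.IsStarProjection.apply_apply {P : H →L[ℂ] H} (hP : IsStarProjection P) (ψ : H) :
    P (P ψ) = P ψ := DFunLike.congr_fun hP.isIdempotentElem ψ

theorem _root_.IsStarProjection.inner_self {P : H →L[ℂ] H} (hP : IsStarProjection P) (ψ : H) :
    inner ℂ ψ (P ψ) = ((‖P ψ‖ ^ 2 : ℝ) : ℂ) := by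
  rw [← hP.apply_apply, ← hP.inner_left, hP.apply_apply, inner_self_eq_norm_sq_to_K]
  simp

/-- `P` is a projection whose quadratic form is `ψ ↦ μ_ψ(s)`. -/
def IsProjFor (μ : H → Measure ℝ) (s : Set ℝ) (P : H →L[ℂ] H) : Prop :=
  IsStarProjection P ∧ ∀ ψ, ‖P ψ‖ ^ 2 = (μ ψ).real s

section

variable {μ : H → Measure ℝ} [∀ ψ, IsFiniteMeasure (μ ψ)] {s t : Set ℝ} {P Q : H →L[ℂ] H}

theorem IsProjFor.unique (hP : IsProjFor μ s P) (hQ : IsProjFor μ s Q) : P = Q := by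
  refine ContinuousLinearMap.coe_injective ((ext_inner_map _ _).1 fun ψ => ?_)
  rw [ContinuousLinearMap.coe_coe, ContinuousLinearMap.coe_coe, hP.1.inner_left,
    hQ.1.inner_left, hP.1.inner_self, hQ.1.inner_self, hP.2, hQ.2]

variable (hμ : ∀ ψ, (μ ψ).real univ = ‖ψ‖ ^ 2)
include hμ

theorem IsProjFor.compl (hP : IsProjFor μ s P) (hs : MeasurableSet s) :
    IsProjFor μ sᶜ (1 - P) := by
  refine ⟨hP.1.one_sub, fun ψ => ?_⟩
  rw [measureReal_compl hs, hμ, ← hP.2]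
  change ‖ψ - P ψ‖ ^ 2 = _
  rw [norm_sub_sq (𝕜 := ℂ), hP.1.inner_self, RCLike.re_to_complex, Complex.ofReal_re]
  ring

theorem IsProjFor.mul_eq_zero (hP : IsProjFor μ s P) (hQ : IsProjFor μ t Q)
    (ht : MeasurableSet t) (h : Disjoint s t) : P * Q = 0 := by
  ext φ
  have h1 := hQ.2 (Q φ)
  have h2 := hP.2 (Q φ)
  rw [hQ.1.apply_apply, ← hμ] at h1
  have h3 := measureReal_union (μ := μ (Q φ)) h ht
  have h4 := measureReal_mono (μ := μ (Q φ)) (subset_univ (s ∪ t))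
  have h5 : ‖P (Q φ)‖ ^ 2 = 0 := le_antisymm (by linarith) (by positivity)
  simpa using h5

theorem IsProjFor.union (hP : IsProjFor μ s P) (hQ : IsProjFor μ t Q)
    (ht : MeasurableSet t) (h : Disjoint s t) :
    IsProjFor μ (s ∪ t) (P + Q) := by
  have h1 := hP.mul_eq_zero hμ hQ ht h
  have h2 : ∀ ψ, ‖(P + Q) ψ‖ ^ 2 = ‖P ψ‖ ^ 2 + ‖Q ψ‖ ^ 2 := fun ψ => by
    have : P (Q ψ) = 0 := DFunLike.congr_fun h1 ψ
    rw [add_apply, norm_add_sq (𝕜 := ℂ), hP.1.inner_left, this]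
    simp
  refine ⟨isStarProjection_of_inner fun ψ => ?_, fun ψ => ?_⟩
  · rw [h2, add_apply, inner_add_right, hP.1.inner_self, hQ.1.inner_self]
    push_cast; rfl
  · rw [h2, hP.2, hQ.2, measureReal_union h ht]

theorem IsProjFor.norm_sub_sq (hP : IsProjFor μ s P) (hQ : IsProjFor μ t Q)
    (hs : MeasurableSet s) (ht : MeasurableSet t) (h : s ⊆ t) (ψ : H) :
    ‖Q ψ - P ψ‖ ^ 2 = (μ ψ).real t - (μ ψ).real s := by
  have h1 := (hQ.compl hμ ht).mul_eq_zero hμ hP hs (disjoint_compl_left_iff_subset.2 h)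
  have h2 : Q (P ψ) = P ψ := by
    have := DFunLike.congr_fun h1 ψ
    exact (sub_eq_zero.1 this).symm
  rw [_root_.norm_sub_sq (𝕜 := ℂ), hQ.1.inner_left, h2, hP.1.inner_self, RCLike.re_to_complex,
    Complex.ofReal_re, hQ.2, hP.2]
  ring

omit hμ in
-- The increments of `T n ψ` are controlled by those of a convergent real sequence, so a strong
-- limit exists. Its form and its squared norm both equal `μ_ψ(s)`, which makes it a projection. The
-- lemma serves both half-lines and countable unions.
theorem exists_isProjFor_of_tendsto {T : ℕ → H →L[ℂ] H} {a b : ℕ → H → ℝ}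
    (ha : ∀ n ψ, inner ℂ ψ (T n ψ) = (a n ψ : ℂ))
    (hT : ∀ n m ψ, n ≤ m → ‖T n ψ - T m ψ‖ ^ 2 ≤ b n ψ - b m ψ)
    (hb : ∀ ψ, ∃ l, Tendsto (fun n => b n ψ) atTop (𝓝 l))
    (hl : ∀ ψ, Tendsto (fun n => a n ψ) atTop (𝓝 ((μ ψ).real s)))
    (hn : ∀ ψ, Tendsto (fun n => ‖T n ψ‖ ^ 2) atTop (𝓝 ((μ ψ).real s))) :
    ∃ P, IsProjFor μ s P := by
  have hc : ∀ ψ, CauchySeq fun n => T n ψ := fun ψ => by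
    obtain ⟨l, hl⟩ := hb ψ
    rw [Metric.cauchySeq_iff']
    intro ε hε
    obtain ⟨N, hN⟩ := Metric.cauchySeq_iff'.1 hl.cauchySeq (ε ^ 2) (by positivity)
    refine ⟨N, fun n hn => ?_⟩
    have h1 := hT N n ψ hn
    have h2 := hN n hn
    rw [dist_comm, dist_eq_norm]
    rw [dist_comm, Real.dist_eq] at h2
    exact lt_of_pow_lt_pow_left₀ 2 hε.le (h1.trans_lt ((le_abs_self _).trans_lt h2))
  choose f hf using fun ψ => cauchySeq_tendsto_of_complete (hc ψ)
  let P : H →L[ℂ] H := continuousLinearMapOfTendsto T (tendsto_pi_nhds.2 hf)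
  have hP : ∀ ψ, Tendsto (fun n => T n ψ) atTop (𝓝 (P ψ)) := hf
  have h1 : ∀ ψ, ‖P ψ‖ ^ 2 = (μ ψ).real s := fun ψ =>
    tendsto_nhds_unique ((hP ψ).norm.pow 2) (hn ψ)
  refine ⟨P, isStarProjection_of_inner fun ψ => ?_, h1⟩
  have h2 : Tendsto (fun n => inner ℂ ψ (T n ψ)) atTop (𝓝 (inner ℂ ψ (P ψ))) :=
    tendsto_const_nhds.inner (hP ψ)
  rw [h1]
  refine tendsto_nhds_unique h2 ?_
  simp_rw [ha]
  exact (Complex.continuous_ofReal.tendsto _).comp (hl ψ)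

theorem exists_isProjFor_iUnion {s : ℕ → Set ℝ} (hs : ∀ n, MeasurableSet (s n))
    (hd : Pairwise (Function.onFun Disjoint s)) (h : ∀ n, ∃ P, IsProjFor μ (s n) P) :
    ∃ P, IsProjFor μ (⋃ n, s n) P := by
  choose P hP using h
  have hm : ∀ n, MeasurableSet (⋃ i < n, s i) := fun n =>
    MeasurableSet.biUnion (to_countable _) fun i _ => hs i
  have hQ : ∀ n, IsProjFor μ (⋃ i < n, s i) (∑ i ∈ Finset.range n, P i) := fun n => by
    induction n with
    | zero => simp [IsProjFor]
    | succ n ih =>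
      rw [Finset.sum_range_succ, biUnion_lt_succ]
      refine ih.union hμ (hP n) (hs n) ?_
      rw [disjoint_iUnion₂_left]
      exact fun i hi => hd hi.ne
  have hmono : Monotone fun n => ⋃ i < n, s i := fun n m hnm =>
    biUnion_subset_biUnion_left fun i (hi : i < n) => hi.trans_le hnm
  have hlim : ∀ ψ, Tendsto (fun n => (μ ψ).real (⋃ i < n, s i)) atTop
      (𝓝 ((μ ψ).real (⋃ n, s n))) := fun ψ => by
    have h1 := tendsto_measure_iUnion_atTop (μ := μ ψ) hmono
    have h2 : ⋃ n, ⋃ i < n, s i = ⋃ n, s n := by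
      ext x
      simp only [mem_iUnion]
      exact ⟨fun ⟨_, i, _, hi⟩ => ⟨i, hi⟩, fun ⟨i, hi⟩ => ⟨i + 1, i, i.lt_succ_self, hi⟩⟩
    rw [h2] at h1
    exact (ENNReal.tendsto_toReal (measure_ne_top _ _)).comp h1
  refine exists_isProjFor_of_tendsto (T := fun n => ∑ i ∈ Finset.range n, P i)
    (a := fun n ψ => (μ ψ).real (⋃ i < n, s i)) (b := fun n ψ => -(μ ψ).real (⋃ i < n, s i))
    (fun n ψ => ?_) (fun n m ψ hnm => ?_) (fun ψ => ⟨_, (hlim ψ).neg⟩) hlim fun ψ => ?_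
  · rw [(hQ n).1.inner_self, (hQ n).2]
  · rw [norm_sub_rev, (hQ n).norm_sub_sq hμ (hQ m) (hm n) (hm m) (hmono hnm)]
    linarith
  · simp_rw [(hQ _).2]
    exact hlim ψ

open Classical in
/-- The resolution assembled from projections with prescribed quadratic forms. -/
def resolutionOfMeasures (h : ∀ s, MeasurableSet s → ∃ P, IsProjFor μ s P) :
    SpectralResolution H where
  proj s := if hs : MeasurableSet s then (h s hs).choose else 0
  isStarProjection s hs := by
    rw [dif_pos hs]
    exact (h s hs).choose_spec.1
  not_measurable s hs := dif_neg hs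
  proj_univ := by
    rw [dif_pos MeasurableSet.univ]
    refine IsProjFor.unique (h _ MeasurableSet.univ).choose_spec ⟨IsStarProjection.one _, fun ψ => ?_⟩
    rw [hμ]; rfl
  hasSum_iUnion s hs hd ψ := by
    have hU := MeasurableSet.iUnion hs
    simp only [hU, hs, dif_pos]
    have hP := fun n => (h _ (hs n)).choose_spec
    set P := fun n => (h _ (hs n)).choose
    have hQ := (h _ hU).choose_spec
    set Q := (h _ hU).choose
    have hm : ∀ F : Finset ℕ, MeasurableSet (⋃ i ∈ F, s i) := fun F =>
      Finset.measurableSet_biUnion F fun i _ => hs i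
    have hF : ∀ F : Finset ℕ, IsProjFor μ (⋃ i ∈ F, s i) (∑ i ∈ F, P i) := fun F => by
      induction F using Finset.induction with
      | empty => simp [IsProjFor]
      | insert n F hn ih =>
        rw [Finset.sum_insert hn, Finset.set_biUnion_insert]
        refine (hP n).union hμ ih (hm F) ?_
        rw [disjoint_iUnion₂_right]
        exact fun i hi => hd fun h => hn (h ▸ hi)
    have hlim : Tendsto (fun F : Finset ℕ => (μ ψ).real (⋃ i ∈ F, s i)) atTop
        (𝓝 ((μ ψ).real (⋃ n, s n))) := by
      have h1 := (ENNReal.summable (f := fun n => μ ψ (s n))).hasSum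
      rw [← measure_iUnion hd hs] at h1
      refine ((ENNReal.tendsto_toReal (measure_ne_top _ _)).comp h1).congr fun F => ?_
      rw [Measure.real, measure_biUnion_finset (fun i _ j _ hij => hd hij) fun i _ => hs i]
      rfl
    change Tendsto (fun F : Finset ℕ => ∑ i ∈ F, P i ψ) atTop (𝓝 (Q ψ))
    rw [tendsto_iff_norm_sub_tendsto_zero]
    -- The squared error is exactly the mass not yet covered by `F`.
    have h2 : ∀ F : Finset ℕ, ‖∑ i ∈ F, P i ψ - Q ψ‖ =
        √((μ ψ).real (⋃ n, s n) - (μ ψ).real (⋃ i ∈ F, s i)) := fun F => by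
      rw [← (hF F).norm_sub_sq hμ hQ (hm F) hU (iUnion₂_subset fun i _ => subset_iUnion s i),
        Real.sqrt_sq (norm_nonneg _), norm_sub_rev, sum_apply]
    simp_rw [h2]
    have h3 := (Real.continuous_sqrt.tendsto _).comp (hlim.const_sub ((μ ψ).real (⋃ n, s n)))
    rw [sub_self, Real.sqrt_zero] at h3
    exact h3

theorem measure_resolutionOfMeasures (h : ∀ s, MeasurableSet s → ∃ P, IsProjFor μ s P) (ψ : H) :
    (resolutionOfMeasures hμ h).measure ψ = μ ψ := by
  ext s hs
  have h1 : (resolutionOfMeasures hμ h).proj s = (h s hs).choose := dif_pos hs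
  rw [SpectralResolution.measure_apply _ hs, h1, (h s hs).choose_spec.2, ofReal_measureReal]

end

section Bounded

variable {T : H →L[ℂ] H}

/-- Riesz–Markov on the compact spectrum for the positive functional `g ↦ ⟪ψ, g(T)ψ⟫`, pushed
forward to `ℝ`. -/
theorem exists_scalar_measure (hT : IsSelfAdjoint T) (ψ : H) :
    ∃ μ : Measure ℝ, IsFiniteMeasure μ ∧ ∀ g : ℝ → ℝ, Continuous g →
      Integrable g μ ∧ inner ℂ ψ (cfc g T ψ) = ((∫ x, g x ∂μ : ℝ) : ℂ) := by
  let X := spectrum ℝ T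
  have : CompactSpace X := isCompact_iff_compactSpace.1 (spectrum.isCompact T)
  let L : CompactlySupportedContinuousMap X ℝ →ₗ[ℝ] ℝ :=
    { toFun := fun g => (inner ℂ ψ (cfcHom hT g.toContinuousMap ψ)).re
      map_add' := fun g k => by
        have : (g + k).toContinuousMap = g.toContinuousMap + k.toContinuousMap := rfl
        rw [this, map_add, add_apply, inner_add_right, Complex.add_re]
      map_smul' := fun c g => by
        have : (c • g).toContinuousMap = c • g.toContinuousMap := rfl
        rw [this, map_smul, smul_apply, ← Complex.coe_smul, inner_smul_right, Complex.re_ofReal_mul]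
        rfl }
  have hL : ∀ g, 0 ≤ g → 0 ≤ L g := fun g hg => by
    have h1 : 0 ≤ cfcHom (R := ℝ) hT g.toContinuousMap := (cfcHom_nonneg_iff hT).2 hg
    rw [ContinuousLinearMap.nonneg_iff_isPositive] at h1
    exact h1.re_inner_nonneg_right ψ
  let Λ := PositiveLinearMap.mk₀ L hL
  let ν := RealRMK.rieszMeasure Λ
  have : IsFiniteMeasure ν := inferInstance
  refine ⟨ν.map Subtype.val, inferInstance, fun g hg => ?_⟩
  let k : C(X, ℝ) := ⟨fun x => g x, by fun_prop⟩
  let k' : CompactlySupportedContinuousMap X ℝ := CompactlySupportedContinuousMap.continuousMapEquiv k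
  have hint : Integrable k' ν := k'.integrable
  have h1 : ∫ x, k' x ∂ν = L k' := RealRMK.integral_rieszMeasure Λ k'
  constructor
  · rw [integrable_map_measure hg.aestronglyMeasurable measurable_subtype_coe.aemeasurable]
    exact hint
  · rw [integral_map measurable_subtype_coe.aemeasurable hg.aestronglyMeasurable]
    have h2 : ∫ x : X, g x ∂ν = L k' := h1
    rw [h2]
    have h3 : cfc g T = cfcHom hT k := by
      rw [cfc_apply g T hT hg.continuousOn]
      rfl
    have h4 : IsSelfAdjoint (cfc g T) := cfc_predicate g T
    rw [h3] at h4 ⊢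
    refine Complex.ext rfl ?_
    rw [Complex.ofReal_im, ← Complex.conj_eq_iff_im, inner_conj_symm]
    have h := ContinuousLinearMap.adjoint_inner_right (cfcHom hT k) ψ ψ
    rw [← ContinuousLinearMap.star_eq_adjoint, h4.star_eq] at h
    exact h.symm

theorem norm_cfc_sq {μ : Measure ℝ} (hT : IsSelfAdjoint T) {ψ : H}
    (h : ∀ g : ℝ → ℝ, Continuous g →
      Integrable g μ ∧ inner ℂ ψ (cfc g T ψ) = ((∫ x, g x ∂μ : ℝ) : ℂ))
    {g : ℝ → ℝ} (hg : Continuous g) : ‖cfc g T ψ‖ ^ 2 = ∫ x, g x ^ 2 ∂μ := by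
  have h1 := (h (fun x => g x ^ 2) (hg.pow 2)).2
  have h2 : IsSelfAdjoint (cfc g T) := cfc_predicate g T
  have h3 := ContinuousLinearMap.adjoint_inner_right (cfc g T) ψ (cfc g T ψ)
  rw [← ContinuousLinearMap.star_eq_adjoint, h2.star_eq, inner_self_eq_norm_sq_to_K] at h3
  rw [cfc_pow g 2 T hg.continuousOn hT, sq, mul_apply_eq_comp, h3] at h1
  exact Complex.ofReal_injective (by simpa using h1)

/-- A continuous approximation of the indicator function of `Iic a`. -/
def iicApprox (a : ℝ) (n : ℕ) (x : ℝ) : ℝ := 1 - min 1 (n * max 0 (x - a))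

theorem continuous_iicApprox (a : ℝ) (n : ℕ) : Continuous (iicApprox a n) := by
  unfold iicApprox
  fun_prop

theorem iicApprox_nonneg (a : ℝ) (n : ℕ) (x : ℝ) : 0 ≤ iicApprox a n x :=
  sub_nonneg.2 (min_le_left _ _)

theorem iicApprox_le_one (a : ℝ) (n : ℕ) (x : ℝ) : iicApprox a n x ≤ 1 :=
  sub_le_self _ (le_min zero_le_one (by positivity))

theorem iicApprox_anti (a : ℝ) {n m : ℕ} (h : n ≤ m) (x : ℝ) :
    iicApprox a m x ≤ iicApprox a n x := by
  unfold iicApprox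
  gcongr

theorem tendsto_iicApprox (a x : ℝ) :
    Tendsto (fun n => iicApprox a n x) atTop (𝓝 ((Iic a).indicator 1 x)) := by
  by_cases hx : x ≤ a
  · have h : ∀ n, iicApprox a n x = 1 := fun n => by
      simp [iicApprox, max_eq_left (sub_nonpos.2 hx)]
    simp [h, hx]
  · push Not at hx
    rw [indicator_of_notMem (by simpa using hx)]
    refine tendsto_const_nhds.congr' ?_
    obtain ⟨N, hN⟩ := exists_nat_gt (x - a)⁻¹
    filter_upwards [eventually_ge_atTop N] with n hn
    have h1 : 0 < x - a := sub_pos.2 hx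
    have h2 : (x - a)⁻¹ ≤ n := hN.le.trans (by exact_mod_cast hn)
    rw [iicApprox, max_eq_right h1.le, min_eq_left, sub_self]
    rwa [inv_le_iff_one_le_mul₀ h1] at h2

theorem exists_isProjFor_Iic {μ : H → Measure ℝ} [∀ ψ, IsFiniteMeasure (μ ψ)]
    (hT : IsSelfAdjoint T) (h : ∀ ψ, ∀ g : ℝ → ℝ, Continuous g →
      Integrable g (μ ψ) ∧ inner ℂ ψ (cfc g T ψ) = ((∫ x, g x ∂(μ ψ) : ℝ) : ℂ)) (a : ℝ) :
    ∃ P, IsProjFor μ (Iic a) P := by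
  -- The case `k = 1` governs quadratic forms and `k = 2` squared norms; the limits coincide because
  -- an indicator equals its square.
  have hlim : ∀ k : ℕ, k ≠ 0 → ∀ ψ, Tendsto (fun n => ∫ x, iicApprox a n x ^ k ∂(μ ψ)) atTop
      (𝓝 ((μ ψ).real (Iic a))) := fun k hk ψ => by
    rw [← integral_indicator_one measurableSet_Iic]
    refine tendsto_integral_of_dominated_convergence (fun _ => 1)
      (fun n => ((continuous_iicApprox a n).pow k).aestronglyMeasurable) (integrable_const 1)
      (fun n => ae_of_all _ fun x => ?_) (ae_of_all _ fun x => ?_)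
    · rw [Real.norm_eq_abs, abs_of_nonneg (pow_nonneg (iicApprox_nonneg a n x) k)]
      exact pow_le_one₀ (iicApprox_nonneg a n x) (iicApprox_le_one a n x)
    · convert (tendsto_iicApprox a x).pow k using 2
      by_cases hx : x ≤ a <;> simp [hx, hk]
  have hlim1 : ∀ ψ, Tendsto (fun n => ∫ x, iicApprox a n x ∂(μ ψ)) atTop
      (𝓝 ((μ ψ).real (Iic a))) := fun ψ => by simpa using hlim 1 one_ne_zero ψ
  refine exists_isProjFor_of_tendsto (T := fun n => cfc (iicApprox a n) T)
    (a := fun n ψ => ∫ x, iicApprox a n x ∂(μ ψ)) (b := fun n ψ => ∫ x, iicApprox a n x ∂(μ ψ))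
    (fun n ψ => (h ψ _ (continuous_iicApprox a n)).2) (fun n m ψ hnm => ?_)
    (fun ψ => ⟨_, hlim1 ψ⟩) hlim1 fun ψ => ?_
  · have hn := continuous_iicApprox a n
    have hm := continuous_iicApprox a m
    have hnm' : Continuous fun x => iicApprox a n x - iicApprox a m x := hn.sub hm
    rw [← sub_apply, ← cfc_sub _ _ T hn.continuousOn hm.continuousOn,
      norm_cfc_sq hT (h ψ) hnm', ← integral_sub (h ψ _ hn).1 (h ψ _ hm).1]
    -- The difference of the two approximants takes values in `[0, 1]`, so its square is at most
    -- itself.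
    refine integral_mono (h ψ _ (hnm'.pow 2)).1 (h ψ _ hnm').1 fun x => ?_
    have h1 := iicApprox_anti a hnm x
    have h2 := iicApprox_le_one a n x
    have h3 := iicApprox_nonneg a m x
    nlinarith
  · simp_rw [norm_cfc_sq hT (h ψ) (continuous_iicApprox a _)]
    exact hlim 2 two_ne_zero ψ

/-- The spectral theorem for bounded self-adjoint operators. -/
theorem exists_resolution_of_isSelfAdjoint (hT : IsSelfAdjoint T) :
    ∃ E : SpectralResolution H, ∀ ψ, MemLp (fun x => x) 2 (E.measure ψ) ∧
      E.int (fun x => x) ψ = T ψ := by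
  choose μ hfin h using exists_scalar_measure hT
  have hμ : ∀ ψ, (μ ψ).real univ = ‖ψ‖ ^ 2 := fun ψ => by
    have h1 := norm_cfc_sq hT (h ψ) (continuous_const (y := (1 : ℝ)))
    rw [cfc_const_one ℝ T hT] at h1
    simpa using h1.symm
  have hP : ∀ s, MeasurableSet s → ∃ P, IsProjFor μ s P := fun s hs => by
    induction s, hs using MeasurableSpace.induction_on_inter (borel_eq_generateFrom_Iic ℝ)
      isPiSystem_Iic with
    | empty => exact ⟨0, by simp [IsProjFor]⟩
    | basic t ht =>
      obtain ⟨a, rfl⟩ := ht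
      exact exists_isProjFor_Iic hT h a
    | compl t ht ih =>
      obtain ⟨P, hP⟩ := ih
      exact ⟨_, hP.compl hμ ht⟩
    | iUnion s hd hs ih => exact exists_isProjFor_iUnion hμ hs hd ih
  let E := resolutionOfMeasures hμ hP
  have hE : ∀ ψ, E.measure ψ = μ ψ := measure_resolutionOfMeasures hμ hP
  have hm : ∀ ψ, MemLp (fun x => x) 2 (E.measure ψ) := fun ψ => by
    rw [memLp_two_iff_integrable_sq (by fun_prop), hE]
    exact (h ψ _ (continuous_id.pow 2)).1
  have h0 := SpectralResolution.linearMap_eq_zero_of_inner_self_eq_zero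
    (SpectralResolution.dense_op_domain (E := E) (f := fun x => x) measurable_id)
    ((E.op fun x => x).toFun - T.toLinearMap ∘ₗ Submodule.subtype _) fun ψ => by
      have h1 : inner ℂ (ψ : H) ((E.op fun x => x).toFun ψ) = _ :=
        SpectralResolution.inner_int_self ψ.2
      have h2 := (h ψ id continuous_id).2
      rw [cfc_id ℝ T hT] at h2
      rw [LinearMap.sub_apply, inner_sub_right, sub_eq_zero, h1, hE]
      exact h2.symm
  refine ⟨E, fun ψ => ⟨hm ψ, ?_⟩⟩
  have h1 := LinearMap.congr_fun h0 ⟨ψ, hm ψ⟩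
  rw [LinearMap.sub_apply, LinearMap.zero_apply, sub_eq_zero] at h1
  exact h1

end Bounded


/-! ### Positive self-adjoint operators given by their graphs -/

section Graph

variable {M : Submodule ℂ (H × H)}

/-- The bounded operator `(1 + A)⁻¹` for a positive operator `A` with graph `M`. -/
theorem exists_resolvent (hsymm : ∀ p ∈ M, ∀ q ∈ M, inner ℂ p.2 q.1 = inner ℂ p.1 q.2)
    (hpos : ∀ p ∈ M, 0 ≤ (inner ℂ p.1 p.2).re) (hsurj : ∀ ψ : H, ∃ w, (w, ψ - w) ∈ M) :
    ∃ T : H →L[ℂ] H, IsSelfAdjoint T ∧ ∀ p, p ∈ M ↔ T (p.1 + p.2) = p.1 := by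
  choose w hw using hsurj
  -- Positivity makes the cross term in `‖ψ + Aψ‖²` nonnegative, so `(1 + A)⁻¹` is well defined and
  -- a contraction.
  have hbound : ∀ p ∈ M, ‖p.1‖ ≤ ‖p.1 + p.2‖ := fun p hp => by
    have h1 := norm_add_sq (𝕜 := ℂ) p.1 p.2
    have h2 := hpos p hp
    rw [RCLike.re_to_complex] at h1
    exact (pow_le_pow_iff_left₀ (norm_nonneg _) (norm_nonneg _) two_ne_zero).1
      (by nlinarith [sq_nonneg ‖p.2‖])
  have huniq : ∀ p ∈ M, w (p.1 + p.2) = p.1 := fun p hp => by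
    have h1 := hbound _ (M.sub_mem (hw (p.1 + p.2)) hp)
    have h2 : w (p.1 + p.2) - p.1 + (p.1 + p.2 - w (p.1 + p.2) - p.2) = 0 := by abel
    simp only [Prod.fst_sub, Prod.snd_sub, h2, norm_zero, norm_le_zero_iff, sub_eq_zero] at h1
    exact h1
  let L : H →ₗ[ℂ] H :=
    { toFun := w
      map_add' := fun x y => by
        have h := huniq _ (M.add_mem (hw x) (hw y))
        simp only [Prod.fst_add, Prod.snd_add] at h
        rw [← h]
        congr 1; abel
      map_smul' := fun c x => by
        have h := huniq _ (M.smul_mem c (hw x))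
        simp only [Prod.smul_fst, Prod.smul_snd] at h
        rw [RingHom.id_apply, ← h]
        congr 1; rw [← smul_add, add_sub_cancel] }
  let T : H →L[ℂ] H := L.mkContinuous 1 fun x => by
    have h := hbound _ (hw x)
    rw [add_sub_cancel] at h
    rw [one_mul]
    exact h
  have hT : ∀ x, T x = w x := fun x => rfl
  refine ⟨T, ?_, fun p => ⟨huniq p, fun h => ?_⟩⟩
  · rw [ContinuousLinearMap.isSelfAdjoint_iff_isSymmetric]
    intro x y
    have h := hsymm _ (hw x) _ (hw y)
    rw [inner_sub_left, inner_sub_right, sub_left_inj] at h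
    exact h.symm
  · have h1 := hw (p.1 + p.2)
    rw [← hT, h, add_sub_cancel_left] at h1
    exact h1

/-- If `(1 + A)⁻¹ = ∫ t dE`, then `A = ∫ (t⁻¹ - 1) dE`, and the image of `E` under `t ↦ t⁻¹ - 1`
resolves `A`. -/
theorem exists_isResolutionOf_toLinearPMap
    (hsymm : ∀ p ∈ M, ∀ q ∈ M, inner ℂ p.2 q.1 = inner ℂ p.1 q.2)
    (hpos : ∀ p ∈ M, 0 ≤ (inner ℂ p.1 p.2).re) (hsurj : ∀ ψ : H, ∃ w, (w, ψ - w) ∈ M)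
    (hfun : ∀ p ∈ M, p.1 = 0 → p.2 = 0) :
    ∃ E : SpectralResolution H, E.IsResolutionOf M.toLinearPMap := by
  obtain ⟨T, hT, hM⟩ := exists_resolvent hsymm hpos hsurj
  obtain ⟨E, hE⟩ := exists_resolution_of_isSelfAdjoint hT
  have hinj : ∀ ψ, T ψ = 0 → ψ = 0 := fun ψ h =>
    hfun (0, ψ) ((hM _).2 (by simpa using h)) rfl
  -- `T` annihilates the range of `E({0})` and is injective, so `{0}` is null and the value `0⁻¹ =
  -- 0` plays no role.
  have hne : ∀ ψ, ∀ᵐ t ∂(E.measure ψ), t ≠ 0 := fun ψ => by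
    have hm : Measurable (({0} : Set ℝ).indicator (1 : ℝ → ℝ)) :=
      measurable_one.indicator (measurableSet_singleton 0)
    have hmem : MemLp (({0} : Set ℝ).indicator 1) 2 (E.measure ψ) :=
      (SpectralResolution.memLp_one ψ).indicator (measurableSet_singleton 0)
    have hz : (fun x : ℝ => x) * ({0} : Set ℝ).indicator 1 = 0 := by
      ext x
      by_cases hx : x = 0 <;> simp [hx]
    have h1 := SpectralResolution.int_int hmem hm (g := fun x => x) measurable_id
      (by rw [hz]; exact MemLp.zero)
    have h2 : E.int 0 ψ = 0 := by
      have := SpectralResolution.int_simple (E := E) 0 ψ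
      rw [SpectralResolution.simple_zero] at this
      exact this
    rw [(hE _).2, hz, h2] at h1
    have h3 := SpectralResolution.enorm_int hmem
    rw [hinj _ h1, enorm_zero, eq_comm, eLpNorm_eq_zero_iff hmem.1 two_ne_zero] at h3
    filter_upwards [h3] with x hx hx0
    simp [hx0] at hx
  have hh : Measurable fun t : ℝ => t⁻¹ - 1 := by fun_prop
  have hid : Measurable fun t : ℝ => t := measurable_id
  have hgraph : M.toLinearPMap.graph = M :=
    Submodule.toLinearPMap_graph_eq M hfun
  have hop : M.toLinearPMap = E.op fun t => t⁻¹ - 1 := by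
    refine LinearPMap.eq_of_eq_graph ?_
    rw [hgraph]
    ext ⟨ψ, χ⟩
    rw [hM, LinearPMap.mem_graph_iff]
    constructor
    · intro h
      dsimp only at h
      set η := ψ + χ with hη
      have e1 : ((fun t : ℝ => t⁻¹ - 1) * fun t => t) =ᵐ[E.measure η] 1 - fun t => t := by
        filter_upwards [hne η] with t ht
        simp only [Pi.mul_apply, Pi.sub_apply, Pi.one_apply]
        field_simp
      have e2 : MemLp ((fun t : ℝ => t⁻¹ - 1) * fun t => t) 2 (E.measure η) :=
        (memLp_congr_ae e1).2 ((SpectralResolution.memLp_one η).sub (hE η).1)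
      have e3 : ψ = E.int (fun t => t) η := by rw [(hE η).2, h]
      have e4 : MemLp (fun t : ℝ => t⁻¹ - 1) 2 (E.measure ψ) := by
        rw [e3]
        exact (SpectralResolution.memLp_int_iff (hE η).1 hid hh).2 e2
      refine ⟨⟨ψ, e4⟩, rfl, ?_⟩
      change E.int (fun t => t⁻¹ - 1) ψ = χ
      rw [e3, SpectralResolution.int_int (hE η).1 hid hh e2, SpectralResolution.int_congr e1,
        SpectralResolution.int_sub (SpectralResolution.memLp_one η) (hE η).1,
        SpectralResolution.int_one, ← e3, hη, add_sub_cancel_left]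
    · rintro ⟨ψ', rfl, h⟩
      obtain ⟨ψ, hψ⟩ := ψ'
      change E.int (fun t => t⁻¹ - 1) ψ = χ at h
      change MemLp (fun t : ℝ => t⁻¹ - 1) 2 (E.measure ψ) at hψ
      have h1 := SpectralResolution.memLp_one (E := E) ψ
      have e1 : ((fun t : ℝ => t) * (1 + fun t => t⁻¹ - 1)) =ᵐ[E.measure ψ] 1 := by
        filter_upwards [hne ψ] with t ht
        simp only [Pi.mul_apply, Pi.add_apply, Pi.one_apply]
        field_simp
        ring
      change T (ψ + χ) = ψ
      have e2 : ψ + χ = E.int (1 + fun t => t⁻¹ - 1) ψ := by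
        rw [SpectralResolution.int_add h1 hψ, h, SpectralResolution.int_one]
      rw [e2, ← (hE _).2, SpectralResolution.int_int (h1.add hψ) (measurable_one.add hh) hid
        ((memLp_congr_ae e1).2 h1), SpectralResolution.int_congr e1, SpectralResolution.int_one]
  refine ⟨E.map _ hh, ?_⟩
  rw [hop]
  exact SpectralResolution.IsIntegral.isIntegral_map (g := fun x => x) hh hid
    (SpectralResolution.isIntegral_op hh)

/-! ### Strict positivity and resolvents in spectral terms -/

variable {E : SpectralResolution H}

theorem mem_graph_op_iff {f : ℝ → ℝ} {ψ χ : H} :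
    (ψ, χ) ∈ (E.op f).graph ↔ MemLp f 2 (E.measure ψ) ∧ E.int f ψ = χ := by
  rw [LinearPMap.mem_graph_iff]
  constructor
  · rintro ⟨⟨φ, hφ⟩, rfl, h⟩
    exact ⟨hφ, h⟩
  · rintro ⟨h1, h2⟩
    exact ⟨⟨ψ, h1⟩, rfl, h2⟩

/-- Cutting `η` down to `(-∞, 0]`, with the factor `(1+x²)⁻¹` to stay in the domain, gives a vector
with nonpositive form. It must vanish, so the cut-off function is almost everywhere zero. -/
theorem ae_pos_of_strictlyPositive
    (h : ∀ p ∈ (E.op fun x => x).graph, (inner ℂ p.1 p.2).re ≤ 0 → p.1 = 0) (η : H) :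
    ∀ᵐ x ∂(E.measure η), 0 < x := by
  have hid : Measurable fun t : ℝ => t := measurable_id
  set g : ℝ → ℝ := (Iic 0).indicator fun x => (1 + x ^ 2)⁻¹ with hg
  have hgm : Measurable g := Measurable.indicator (by fun_prop) measurableSet_Iic
  have hgL : MemLp g 2 (E.measure η) :=
    (SpectralResolution.memLp_inv_one_add_sq hid η).indicator measurableSet_Iic
  have hxg : MemLp ((fun x => x) * g) 2 (E.measure η) := by
    have e : (fun x => x) * g = (Iic 0).indicator fun x => x * (1 + x ^ 2)⁻¹ := by
      ext x
      by_cases hx : x ∈ Iic (0 : ℝ) <;> simp only [hg, Pi.mul_apply, indicator, hx, if_true, if_false, mul_zero]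
    rw [e]
    exact (SpectralResolution.memLp_div_one_add_sq hid η).indicator measurableSet_Iic
  set ψ := E.int g η with hψ
  have hψm : MemLp (fun x => x) 2 (E.measure ψ) :=
    (SpectralResolution.memLp_int_iff hgL hgm hid).2 hxg
  have h1 := h _ (mem_graph_op_iff.2 ⟨hψm, rfl⟩)
  dsimp only at h1
  rw [SpectralResolution.inner_int_self hψm, Complex.ofReal_re] at h1
  have h2 : ∀ᵐ x ∂(E.measure ψ), x ≤ 0 := by
    rw [hψ, SpectralResolution.measure_int hgL, ae_withDensity_iff (by fun_prop)]
    refine ae_of_all _ fun x hx => ?_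
    by_contra hx'
    exact hx (by simp [hg, hx'])
  have h3 := h1 (integral_nonpos_of_ae h2)
  have h4 := SpectralResolution.enorm_int hgL
  rw [← hψ, h3, enorm_zero, eq_comm, eLpNorm_eq_zero_iff hgL.1 two_ne_zero] at h4
  filter_upwards [h4] with x hx
  by_contra hx'
  have : g x = (1 + x ^ 2)⁻¹ := indicator_of_mem (mem_Iic.2 (not_lt.1 hx')) _
  rw [this] at hx
  have : (1 + x ^ 2)⁻¹ ≠ 0 := by positivity
  exact this hx

theorem exists_resolvent_of_ae_pos (h : ∀ ψ, ∀ᵐ x ∂(E.measure ψ), 0 < x) {l : ℝ} (hl : 0 < l)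
    (ψ : H) : ∃ u, (u, ψ - (l : ℂ) • u) ∈ (E.op fun x => x).graph ∧
      inner ℂ ψ u = ((∫ x, (x + l)⁻¹ ∂(E.measure ψ) : ℝ) : ℂ) := by
  have hid : Measurable fun t : ℝ => t := measurable_id
  have hgm : Measurable fun x : ℝ => (x + l)⁻¹ := by fun_prop
  have hg : MemLp (fun x => (x + l)⁻¹) 2 (E.measure ψ) := by
    refine MemLp.of_bound hgm.aestronglyMeasurable l⁻¹ ?_
    filter_upwards [h ψ] with x hx
    rw [Real.norm_eq_abs, abs_of_pos (by positivity)]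
    exact inv_anti₀ hl (by linarith)
  have e : ((fun x : ℝ => x) * fun x => (x + l)⁻¹) =ᵐ[E.measure ψ] 1 - l • fun x => (x + l)⁻¹ := by
    filter_upwards [h ψ] with x hx
    simp only [Pi.mul_apply, Pi.sub_apply, Pi.one_apply, Pi.smul_apply, smul_eq_mul]
    field_simp
    ring
  have h1 := SpectralResolution.memLp_one (E := E) ψ
  have hxg := (memLp_congr_ae e).2 (h1.sub (hg.const_smul l))
  refine ⟨E.int (fun x => (x + l)⁻¹) ψ, mem_graph_op_iff.2
    ⟨(SpectralResolution.memLp_int_iff hg hgm hid).2 hxg, ?_⟩, SpectralResolution.inner_int_self hg⟩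
  rw [SpectralResolution.int_int hg hgm hid hxg, SpectralResolution.int_congr e,
    SpectralResolution.int_sub h1 (hg.const_smul l), SpectralResolution.int_one,
    SpectralResolution.int_smul l hg]

end Graph


/-! ### The relative modular operator -/

section Modular

variable {R : VonNeumannAlgebra H} {Ωt Ω : H}

theorem mem_tomitaGraph {a : H →L[ℂ] H} (ha : a ∈ R) : (a Ω, star a Ωt) ∈ tomitaGraph R Ωt Ω :=
  subset_closure ⟨a, ha, rfl⟩

theorem modularGraph_symm {p q : H × H} (hp : p ∈ modularGraph R Ωt Ω)
    (hq : q ∈ modularGraph R Ωt Ω) : inner ℂ p.2 q.1 = inner ℂ p.1 q.2 := by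
  obtain ⟨φ, h1, h2⟩ := hp
  obtain ⟨φ', h1', h2'⟩ := hq
  rw [h2 _ h1', ← inner_conj_symm p.1, h2' _ h1, inner_conj_symm]

theorem modularGraph_inner {p : H × H} (hp : p ∈ modularGraph R Ωt Ω) :
    ∃ φ, (p.1, φ) ∈ tomitaGraph R Ωt Ω ∧ (∀ q ∈ tomitaGraph R Ωt Ω, inner ℂ p.2 q.1 = inner ℂ q.2 φ)
      ∧ (inner ℂ p.1 p.2).re = ‖φ‖ ^ 2 := by
  obtain ⟨φ, h1, h2⟩ := hp
  refine ⟨φ, h1, h2, ?_⟩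
  rw [← inner_conj_symm, h2 _ h1, Complex.conj_re]
  exact inner_self_eq_norm_sq (𝕜 := ℂ) φ

/-- From `⟪ψ, S*Sψ⟫ = ‖Sψ‖²`, a zero first component forces `Sψ = 0`; the second component is then
orthogonal to the dense set `R Ω`. So `S*S` is single-valued. -/
theorem modularGraph_snd_eq_zero (hΩ : IsStandard R Ω) {p : H × H}
    (hp : p ∈ modularGraph R Ωt Ω) (h0 : p.1 = 0) : p.2 = 0 := by
  obtain ⟨φ, h1, h2, h3⟩ := modularGraph_inner hp
  rw [h0, inner_zero_left, Complex.zero_re, eq_comm, sq_eq_zero_iff, norm_eq_zero] at h3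
  refine hΩ.cyclic.eq_zero_of_inner_left (𝕜 := ℂ) ?_
  rintro _ ⟨a, ha, rfl⟩
  rw [h2 _ (mem_tomitaGraph ha), h3, inner_zero_right]

/-- Real scalars are needed because the graph of an antilinear operator is only a real subspace. -/
theorem exists_orthogonal_decomposition {V : Type*} [NormedAddCommGroup V] [InnerProductSpace ℝ V]
    [CompleteSpace V] (S : Set V) (hS : IsClosed S) (h0 : (0 : V) ∈ S)
    (hadd : ∀ x ∈ S, ∀ y ∈ S, x + y ∈ S) (hsmul : ∀ (c : ℝ), ∀ x ∈ S, c • x ∈ S) (v : V) :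
    ∃ u ∈ S, ∀ q ∈ S, inner ℝ (v - u) q = 0 := by
  let K : Submodule ℝ V :=
    { carrier := S
      zero_mem' := h0
      add_mem' := fun hx hy => hadd _ hx _ hy
      smul_mem' := hsmul }
  have hK : IsClosed (K : Set V) := hS
  have : CompleteSpace K := hK.completeSpace_coe
  exact ⟨K.starProjection v, K.starProjection_apply_mem v, fun q hq =>
    K.starProjection_inner_eq_zero v q hq⟩

/-- The resolvent of the relative modular operator is obtained from the orthogonal projection onto
the graph of the relative Tomita operator. -/
theorem modularGraph_surjective (ψ : H) : ∃ w, (w, ψ - w) ∈ modularGraph R Ωt Ω := by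
  let _ : InnerProductSpace ℝ (WithLp 2 (H × H)) := InnerProductSpace.rclikeToReal ℂ _
  obtain ⟨u, hu, horth'⟩ := exists_orthogonal_decomposition
    {p : WithLp 2 (H × H) | WithLp.ofLp p ∈ tomitaGraph R Ωt Ω}
    (isClosed_closure.preimage (WithLp.prod_continuous_ofLp 2 H H)) (tomitaGraph_zero R Ωt Ω)
    (fun p hp q hq => tomitaGraph_add R Ωt Ω hp hq)
    (fun c p hp => by
      have h := tomitaGraph_smul R Ωt Ω (c : ℂ) hp
      rw [Complex.star_def, Complex.conj_ofReal] at h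
      exact h) (WithLp.toLp 2 (ψ, 0))
  have horth : ∀ q ∈ tomitaGraph R Ωt Ω,
      (inner ℂ (ψ - (WithLp.ofLp u).1) q.1).re - (inner ℂ q.2 (WithLp.ofLp u).2).re = 0 := by
    intro q hq
    have h := horth' (WithLp.toLp 2 q) hq
    change (inner ℂ (ψ - (WithLp.ofLp u).1) q.1).re +
      (inner ℂ (0 - (WithLp.ofLp u).2) q.2).re = 0 at h
    rw [zero_sub, inner_neg_left, Complex.neg_re, ← inner_conj_symm (WithLp.ofLp u).2,
      Complex.conj_re] at h
    exact h
  refine ⟨(WithLp.ofLp u).1, (WithLp.ofLp u).2, hu, fun q hq => ?_⟩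
  have h1 := horth q hq
  -- The pair `(i q.1, -i q.2)` is also in the graph and multiplies both inner products by `i`,
  -- which recovers the imaginary part.
  have h2 := horth _ (tomitaGraph_smul R Ωt Ω Complex.I hq)
  simp only [inner_smul_left, inner_smul_right, Complex.star_def, Complex.conj_I, map_neg, neg_neg,
    Complex.I_mul_re] at h2
  exact Complex.ext (by linarith) (by dsimp only; linarith)

theorem exists_isResolutionOf_relModularOperator (hΩ : IsStandard R Ω) :
    ∃ E : SpectralResolution H, E.IsResolutionOf (relModularOperator R Ωt Ω) :=
  exists_isResolutionOf_toLinearPMap (fun _ hp _ hq => modularGraph_symm hp hq)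
    (fun _ hp => by
      obtain ⟨φ, -, -, h⟩ := modularGraph_inner hp
      rw [h]
      positivity)
    modularGraph_surjective fun _ => modularGraph_snd_eq_zero hΩ

theorem graph_relModularOperator (hΩ : IsStandard R Ω) :
    (relModularOperator R Ωt Ω).graph = modularGraph R Ωt Ω :=
  Submodule.toLinearPMap_graph_eq _ fun _ => modularGraph_snd_eq_zero hΩ

/-- A separating vector is cyclic for the commutant. -/
theorem eq_zero_of_inner_commutant_eq_zero (hsep : ∀ a ∈ R, a Ω = 0 → a = 0) {ψ : H}
    (h : ∀ b ∈ R.commutant, inner ℂ (b Ω) ψ = 0) : ψ = 0 := by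
  let K : Submodule ℂ H :=
    { carrier := {φ | ∀ b ∈ R.commutant, inner ℂ (b Ω) φ = 0}
      zero_mem' := fun b _ => inner_zero_right _
      add_mem' := fun h h' b hb => by rw [inner_add_right, h b hb, h' b hb, add_zero]
      smul_mem' := fun c φ h b hb => by rw [inner_smul_right, h b hb, mul_zero] }
  have hK : IsClosed (K : Set H) := by
    have : (K : Set H) = ⋂ b ∈ R.commutant, {φ | inner ℂ (b Ω) φ = 0} := by
      ext φ
      simp only [mem_iInter]
      rfl
    rw [this]
    exact isClosed_biInter fun b _ => isClosed_eq (by fun_prop) continuous_const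
  have : CompleteSpace K := hK.completeSpace_coe
  have hP : IsStarProjection K.starProjection := isStarProjection_starProjection
  -- The orthogonal complement `K` of `R' Ω` is invariant under `R'`, so its projection lies in `R''
  -- = R`; it kills `Ω` because `1 ∈ R'`.
  have hR : K.starProjection ∈ R := by
    rw [VonNeumannAlgebra.IsStarProjection.mem_iff hP]
    intro y hy
    rw [Submodule.range_starProjection, Module.End.mem_invtSubmodule_iff_forall_mem_of_mem]
    intro φ hφ b hb
    have h1 := hφ (star y * b) (mul_mem (star_mem hy) hb)
    rw [mul_apply_eq_comp, ContinuousLinearMap.star_eq_adjoint,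
      ContinuousLinearMap.adjoint_inner_left] at h1
    exact h1
  have h0 : K.starProjection Ω = 0 := by
    rw [Submodule.starProjection_apply_eq_zero_iff]
    intro φ hφ
    have h1 := hφ 1 (one_mem _)
    rw [← inner_conj_symm]
    rw [one_apply_eq_self] at h1
    rw [h1, map_zero]
  have h1 := hsep _ hR h0
  have h2 : K.starProjection ψ = ψ := Submodule.starProjection_eq_self_iff.2 h
  rw [← h2, h1, zero_apply]

/-- The commutant supplies vectors in the domain of `S*`, with `S*(bΩ) = b*Ωt`; the identity holds
on `R Ω` by commutation and survives closure. -/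
theorem inner_commutant {b : H →L[ℂ] H} (hb : b ∈ R.commutant) {q : H × H}
    (hq : q ∈ tomitaGraph R Ωt Ω) : inner ℂ q.2 (b Ω) = inner ℂ (star b Ωt) q.1 := by
  have hc : IsClosed {q : H × H | inner ℂ q.2 (b Ω) = inner ℂ (star b Ωt) q.1} :=
    isClosed_eq (by fun_prop) (by fun_prop)
  refine closure_minimal ?_ hc hq
  rintro _ ⟨a, ha, rfl⟩
  have h := DFunLike.congr_fun (VonNeumannAlgebra.mem_commutant_iff.1 hb a ha) Ω
  simp only [mul_apply_eq_comp] at h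
  simp only [mem_ofPred_eq, ContinuousLinearMap.star_eq_adjoint,
    ContinuousLinearMap.adjoint_inner_left, h]

/-- Pairing with the commutant shows `ψ` orthogonal to `R' Ωt`, which is dense since `Ωt` is
separating. So the closed operator `S` is injective. -/
theorem eq_zero_of_mem_tomitaGraph (hΩt : IsStandard R Ωt) {ψ : H}
    (h : (ψ, (0 : H)) ∈ tomitaGraph R Ωt Ω) : ψ = 0 := by
  refine eq_zero_of_inner_commutant_eq_zero hΩt.separating fun b hb => ?_
  have h1 := inner_commutant (star_mem hb) h
  rw [star_star, inner_zero_left] at h1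
  exact h1.symm

theorem modularGraph_strictlyPositive (hΩt : IsStandard R Ωt) {p : H × H}
    (hp : p ∈ modularGraph R Ωt Ω) (h : (inner ℂ p.1 p.2).re ≤ 0) : p.1 = 0 := by
  obtain ⟨φ, h1, -, h3⟩ := modularGraph_inner hp
  have h4 : φ = 0 := by
    have : ‖φ‖ ^ 2 = 0 := le_antisymm (h3 ▸ h) (by positivity)
    simpa using this
  exact eq_zero_of_mem_tomitaGraph hΩt (h4 ▸ h1)

/-- Variational principle for the resolvent of the relative modular operator. -/
theorem resolvent_variational {l : ℝ} (hl : 0 < l) {ψ w : H}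
    (hw : (w, ψ - (l : ℂ) • w) ∈ modularGraph R Ωt Ω) {u v : H}
    (huv : (u, v) ∈ tomitaGraph R Ωt Ω) :
    2 * (inner ℂ ψ u).re - l * ‖u‖ ^ 2 - ‖v‖ ^ 2 ≤ (inner ℂ ψ w).re := by
  obtain ⟨φ, h1, h2, h3⟩ := modularGraph_inner hw
  have key : ∀ z y, (z, y) ∈ tomitaGraph R Ωt Ω →
      (inner ℂ ψ z).re = l * (inner ℂ w z).re + (inner ℂ y φ).re := fun z y hz => by
    have h := congrArg Complex.re (h2 _ hz)
    rw [inner_sub_left, inner_smul_left, Complex.conj_ofReal, Complex.sub_re,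
      Complex.re_ofReal_mul] at h
    linarith
  have hsq : ∀ x : H, (inner ℂ x x).re = ‖x‖ ^ 2 := fun x => inner_self_eq_norm_sq (𝕜 := ℂ) x
  rw [key u v huv, key w φ h1, hsq, hsq]
  -- Completing squares: the right side minus the left equals `l‖w - u‖² + ‖v - φ‖²`.
  have e1 := norm_sub_sq (𝕜 := ℂ) w u
  have e2 := norm_sub_sq (𝕜 := ℂ) v φ
  rw [RCLike.re_to_complex] at e1 e2
  nlinarith [sq_nonneg ‖w - u‖, sq_nonneg ‖v - φ‖, mul_nonneg hl.le (sq_nonneg ‖w - u‖)]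

theorem inner_resolvent {l : ℝ} {ψ w : H}
    (hw : (w, ψ - (l : ℂ) • w) ∈ modularGraph R Ωt Ω) :
    ∃ φ, (w, φ) ∈ tomitaGraph R Ωt Ω ∧ (inner ℂ ψ w).re = l * ‖w‖ ^ 2 + ‖φ‖ ^ 2 := by
  obtain ⟨φ, h1, -, h3⟩ := modularGraph_inner hw
  refine ⟨φ, h1, ?_⟩
  have hsq : ∀ x : H, (inner ℂ x x).re = ‖x‖ ^ 2 := fun x => inner_self_eq_norm_sq (𝕜 := ℂ) x
  rw [inner_sub_right, inner_smul_right, Complex.sub_re, Complex.re_ofReal_mul, hsq] at h3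
  rw [← inner_conj_symm, Complex.conj_re]
  linarith

/-- The maximizer for the smaller algebra is an admissible competitor for the larger one. -/
theorem resolvent_mono {R₁ R₂ : VonNeumannAlgebra H} (hR : R₁ ≤ R₂) {l : ℝ} (hl : 0 < l)
    {ψ w₁ w₂ : H} (h₁ : (w₁, ψ - (l : ℂ) • w₁) ∈ modularGraph R₁ Ωt Ω)
    (h₂ : (w₂, ψ - (l : ℂ) • w₂) ∈ modularGraph R₂ Ωt Ω) :
    (inner ℂ ψ w₁).re ≤ (inner ℂ ψ w₂).re := by
  obtain ⟨φ, h3, h4⟩ := inner_resolvent h₁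
  have h5 : (w₁, φ) ∈ tomitaGraph R₂ Ωt Ω :=
    closure_mono (by rintro p ⟨a, ha, hp⟩; exact ⟨a, hR ha, hp⟩) h3
  have h6 := resolvent_variational hl h₂ h5
  linarith

theorem resolvent_lower_bound {l : ℝ} (hl : 0 < l) {w : H}
    (hw : (w, Ω - (l : ℂ) • w) ∈ modularGraph R Ωt Ω) :
    ‖Ω‖ ^ 2 / l - (inner ℂ Ω w).re ≤ ‖Ωt‖ ^ 2 / l ^ 2 := by
  have h1 : (Ω, Ωt) ∈ tomitaGraph R Ωt Ω := by
    have := mem_tomitaGraph (R := R) (Ωt := Ωt) (Ω := Ω) (one_mem R)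
    rwa [star_one] at this
  -- Among multiples `t (Ω, Ωt)`, the choice `t = l⁻¹` maximizes `2t‖Ω‖² - l t²‖Ω‖²`, leaving only
  -- the `‖Ωt‖²` term as error.
  have h2 := resolvent_variational hl hw (tomitaGraph_smul R Ωt Ω ((l⁻¹ : ℝ) : ℂ) h1)
  have h3 : (inner ℂ Ω Ω).re = ‖Ω‖ ^ 2 := inner_self_eq_norm_sq (𝕜 := ℂ) Ω
  simp only [inner_smul_right, Complex.re_ofReal_mul, h3, norm_smul, Complex.star_def,
    Complex.conj_ofReal, Complex.norm_real, Real.norm_eq_abs, mul_pow, sq_abs] at h2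
  have h4 : 2 * (l⁻¹ * ‖Ω‖ ^ 2) - l * (l⁻¹ ^ 2 * ‖Ω‖ ^ 2) - l⁻¹ ^ 2 * ‖Ωt‖ ^ 2 =
      ‖Ω‖ ^ 2 / l - ‖Ωt‖ ^ 2 / l ^ 2 := by
    field_simp
    ring
  linarith

end Modular


/-! ### Logarithmic integrals and Stieltjes transforms -/

section Log

theorem lintegral_Ioc_inv_add {x : ℝ} (hx : 0 < x) :
    ∫⁻ l in Ioc (0 : ℝ) 1, ENNReal.ofReal (x + l)⁻¹ =
      ENNReal.ofReal (Real.log (x + 1) - Real.log x) := by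
  have hd : ∀ l ∈ uIcc (0 : ℝ) 1, HasDerivAt (fun l => Real.log (x + l)) (x + l)⁻¹ l :=
    fun l hl => by
      rw [uIcc_of_le zero_le_one] at hl
      have h := ((hasDerivAt_id l).const_add x).log (by have := hl.1; simp only [id]; positivity)
      simpa using h
  have hc : ContinuousOn (fun l : ℝ => (x + l)⁻¹) (uIcc 0 1) := by
    rw [uIcc_of_le zero_le_one]
    refine ContinuousOn.inv₀ (by fun_prop) fun l hl => ?_
    have := hl.1
    positivity
  have hi := hc.intervalIntegrable (μ := volume)
  have h := intervalIntegral.integral_eq_sub_of_hasDerivAt hd hi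
  rw [intervalIntegral.integral_of_le zero_le_one, add_zero] at h
  rw [← h, ofReal_integral_eq_lintegral_ofReal]
  · exact (intervalIntegrable_iff_integrableOn_Ioc_of_le zero_le_one).1 hi
  · filter_upwards [self_mem_ae_restrict measurableSet_Ioc] with l hl
    have := hl.1
    positivity

theorem lintegral_Ioi_inv_sub_inv_add {x : ℝ} (hx : 0 < x) :
    ∫⁻ l in Ioi (1 : ℝ), ENNReal.ofReal (l⁻¹ - (x + l)⁻¹) = ENNReal.ofReal (Real.log (x + 1)) := by
  have hd : ∀ l ∈ Ici (1 : ℝ),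
      HasDerivAt (fun l => Real.log l - Real.log (x + l)) (l⁻¹ - (x + l)⁻¹) l := fun l hl => by
    have hl' : 0 < l := zero_lt_one.trans_le hl
    have h := ((hasDerivAt_id l).const_add x).log (by simp only [id]; positivity)
    have h' := (Real.hasDerivAt_log hl'.ne').sub h
    rw [one_div] at h'
    exact h'
  have hpos : ∀ l ∈ Ioi (1 : ℝ), 0 ≤ l⁻¹ - (x + l)⁻¹ := fun l hl => by
    have hl' : 0 < l := zero_lt_one.trans hl
    exact sub_nonneg.2 (inv_anti₀ hl' (by linarith))
  have hlim : Tendsto (fun l => Real.log l - Real.log (x + l)) atTop (𝓝 0) := by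
    have h1 : Tendsto (fun l : ℝ => x / l + 1) atTop (𝓝 1) := by
      simpa using (tendsto_const_nhds (x := x)).div_atTop tendsto_id |>.add_const 1
    have h2 := ((Real.continuousAt_log one_ne_zero).tendsto.comp h1).neg
    rw [Real.log_one, neg_zero] at h2
    refine h2.congr' ?_
    filter_upwards [eventually_gt_atTop 0] with l hl
    have h3 : x / l + 1 = (x + l) / l := by field_simp
    rw [Function.comp_apply, h3, Real.log_div (by positivity) hl.ne']
    ring
  have h := integral_Ioi_of_hasDerivAt_of_nonneg' hd hpos hlim
  rw [Real.log_one, zero_sub, zero_sub, neg_neg] at h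
  rw [← h, ofReal_integral_eq_lintegral_ofReal (integrableOn_Ioi_deriv_of_nonneg' hd hpos hlim)]
  filter_upwards [self_mem_ae_restrict measurableSet_Ioi] with l hl using hpos l hl

variable {μ : Measure ℝ} [IsFiniteMeasure μ]

theorem integrable_inv_add (hμ : ∀ᵐ x ∂μ, 0 < x) {l : ℝ} (hl : 0 < l) :
    Integrable (fun x => (x + l)⁻¹) μ := by
  refine Integrable.of_bound (by fun_prop) l⁻¹ ?_
  filter_upwards [hμ] with x hx
  rw [Real.norm_eq_abs, abs_of_pos (by positivity)]
  exact inv_anti₀ hl (by linarith)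

theorem lintegral_log_sub_log (hμ : ∀ᵐ x ∂μ, 0 < x) :
    ∫⁻ x, ENNReal.ofReal (Real.log (x + 1) - Real.log x) ∂μ =
      ∫⁻ l in Ioc (0 : ℝ) 1, ENNReal.ofReal (∫ x, (x + l)⁻¹ ∂μ) := by
  have h1 : ∫⁻ x, ENNReal.ofReal (Real.log (x + 1) - Real.log x) ∂μ =
      ∫⁻ x, ∫⁻ l in Ioc (0 : ℝ) 1, ENNReal.ofReal (x + l)⁻¹ ∂volume ∂μ := by
    refine lintegral_congr_ae ?_
    filter_upwards [hμ] with x hx using (lintegral_Ioc_inv_add hx).symm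
  rw [h1, lintegral_lintegral_swap (by fun_prop)]
  refine setLIntegral_congr_fun measurableSet_Ioc fun l hl => ?_
  rw [ofReal_integral_eq_lintegral_ofReal (integrable_inv_add hμ hl.1)]
  filter_upwards [hμ] with x hx
  have := hl.1
  positivity

theorem lintegral_log_add_one (hμ : ∀ᵐ x ∂μ, 0 < x) :
    ∫⁻ x, ENNReal.ofReal (Real.log (x + 1)) ∂μ =
      ∫⁻ l in Ioi (1 : ℝ), ENNReal.ofReal (μ.real univ / l - ∫ x, (x + l)⁻¹ ∂μ) := by
  have h1 : ∫⁻ x, ENNReal.ofReal (Real.log (x + 1)) ∂μ =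
      ∫⁻ x, ∫⁻ l in Ioi (1 : ℝ), ENNReal.ofReal (l⁻¹ - (x + l)⁻¹) ∂volume ∂μ := by
    refine lintegral_congr_ae ?_
    filter_upwards [hμ] with x hx using (lintegral_Ioi_inv_sub_inv_add hx).symm
  rw [h1, lintegral_lintegral_swap (by fun_prop)]
  refine setLIntegral_congr_fun measurableSet_Ioi fun l hl => ?_
  have hl' : 0 < l := zero_lt_one.trans hl
  have hi := integrable_inv_add hμ hl'
  have hi' : Integrable (fun x => l⁻¹ - (x + l)⁻¹) μ := (integrable_const _).sub hi
  rw [← ofReal_integral_eq_lintegral_ofReal hi',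
    integral_sub (integrable_const _) hi, integral_const, smul_eq_mul, div_eq_mul_inv]
  filter_upwards [hμ] with x hx
  exact sub_nonneg.2 (inv_anti₀ hl' (by linarith))

/-- The splitting of `-log x`, with negative terms moved across so that it holds in `[0, ∞]` without
subtracting infinities. -/
theorem lintegral_log_identity (hμ : ∀ᵐ x ∂μ, 0 < x) :
    ∫⁻ x, ENNReal.ofReal (-Real.log x) ∂μ + ∫⁻ x, ENNReal.ofReal (Real.log (x + 1)) ∂μ =
      ∫⁻ x, ENNReal.ofReal (Real.log (x + 1) - Real.log x) ∂μ +
        ∫⁻ x, ENNReal.ofReal (Real.log x) ∂μ := by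
  rw [← lintegral_add_left (by fun_prop), ← lintegral_add_left (by fun_prop)]
  refine lintegral_congr_ae ?_
  filter_upwards [hμ] with x hx
  have h1 : 0 ≤ Real.log (x + 1) := Real.log_nonneg (by linarith)
  have h2 : Real.log x ≤ Real.log (x + 1) := Real.log_le_log hx (by linarith)
  rcases le_total 0 (Real.log x) with h | h
  · rw [ENNReal.ofReal_of_nonpos (by linarith), zero_add, ← ENNReal.ofReal_add (by linarith) h,
      sub_add_cancel]
  · rw [ENNReal.ofReal_of_nonpos h, add_zero, ← ENNReal.ofReal_add (by linarith) h1]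
    congr 1; ring

/-- The integrands differ by at most `log 2`, as `x + 1 ≤ 2 max(1, x)`, and the measure is finite.
-/
theorem lintegral_log_sub_log_ne_top_iff (hμ : ∀ᵐ x ∂μ, 0 < x) :
    ∫⁻ x, ENNReal.ofReal (Real.log (x + 1) - Real.log x) ∂μ ≠ ⊤ ↔
      ∫⁻ x, ENNReal.ofReal (-Real.log x) ∂μ ≠ ⊤ := by
  constructor
  · refine fun h => ne_top_of_le_ne_top h (lintegral_mono_ae ?_)
    filter_upwards [hμ] with x hx
    have h1 : 0 ≤ Real.log (x + 1) := Real.log_nonneg (by linarith)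
    exact ENNReal.ofReal_le_ofReal (by linarith)
  · intro h
    have h2 : ∫⁻ x, (ENNReal.ofReal (-Real.log x) + ENNReal.ofReal (Real.log 2)) ∂μ ≠ ⊤ := by
      rw [lintegral_add_right _ measurable_const, lintegral_const]
      exact ENNReal.add_ne_top.2 ⟨h, ENNReal.mul_ne_top ENNReal.ofReal_ne_top (measure_ne_top _ _)⟩
    refine ne_top_of_le_ne_top h2 (lintegral_mono_ae ?_)
    filter_upwards [hμ] with x hx
    have h3 : 0 ≤ Real.log 2 := Real.log_nonneg (by norm_num)
    rcases le_total x 1 with hx1 | hx1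
    · have h4 : Real.log x ≤ 0 := Real.log_nonpos hx.le hx1
      rw [← ENNReal.ofReal_add (by linarith) h3]
      have h5 : Real.log (x + 1) ≤ Real.log 2 := Real.log_le_log (by linarith) (by linarith)
      exact ENNReal.ofReal_le_ofReal (by linarith)
    · refine le_add_left (ENNReal.ofReal_le_ofReal ?_)
      have h5 : Real.log (x + 1) ≤ Real.log (2 * x) := Real.log_le_log (by linarith) (by linarith)
      rw [Real.log_mul two_ne_zero hx.ne'] at h5
      linarith

theorem lintegral_log_add_one_ne_top_iff (hμ : ∀ᵐ x ∂μ, 0 < x) :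
    ∫⁻ x, ENNReal.ofReal (Real.log (x + 1)) ∂μ ≠ ⊤ ↔
      ∫⁻ x, ENNReal.ofReal (Real.log x) ∂μ ≠ ⊤ := by
  constructor
  · refine fun h => ne_top_of_le_ne_top h (lintegral_mono_ae ?_)
    filter_upwards [hμ] with x hx
    exact ENNReal.ofReal_le_ofReal (Real.log_le_log hx (by linarith))
  · intro h
    have h2 : ∫⁻ x, (ENNReal.ofReal (Real.log x) + ENNReal.ofReal (Real.log 2)) ∂μ ≠ ⊤ := by
      rw [lintegral_add_right _ measurable_const, lintegral_const]
      exact ENNReal.add_ne_top.2 ⟨h, ENNReal.mul_ne_top ENNReal.ofReal_ne_top (measure_ne_top _ _)⟩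
    refine ne_top_of_le_ne_top h2 (lintegral_mono_ae ?_)
    filter_upwards [hμ] with x hx
    have h3 : 0 ≤ Real.log 2 := Real.log_nonneg (by norm_num)
    rcases le_total x 1 with hx1 | hx1
    · refine le_add_left (ENNReal.ofReal_le_ofReal ?_)
      exact Real.log_le_log (by linarith) (by linarith)
    · have h4 : 0 ≤ Real.log x := Real.log_nonneg hx1
      rw [← ENNReal.ofReal_add h4 h3]
      have h5 : Real.log (x + 1) ≤ Real.log (2 * x) := Real.log_le_log (by linarith) (by linarith)
      rw [Real.log_mul two_ne_zero hx.ne'] at h5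
      exact ENNReal.ofReal_le_ofReal (by linarith)

/-- If `p₂` or `n₁` is infinite the inequality is trivial. Otherwise the equivalences and
monotonicity make all eight quantities finite, where `p - n = a - b`. -/
theorem coe_sub_coe_le_coe_sub_coe {p₁ n₁ p₂ n₂ a₁ b₁ a₂ b₂ : ℝ≥0∞} (h₁ : p₁ + b₁ = a₁ + n₁)
    (h₂ : p₂ + b₂ = a₂ + n₂) (ha : a₁ ≤ a₂) (hb : b₂ ≤ b₁)
    (ha₁ : a₁ ≠ ⊤ ↔ p₁ ≠ ⊤) (ha₂ : a₂ ≠ ⊤ ↔ p₂ ≠ ⊤)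
    (hb₁ : b₁ ≠ ⊤ ↔ n₁ ≠ ⊤) (hb₂ : b₂ ≠ ⊤ ↔ n₂ ≠ ⊤) (hd₁ : p₁ ≠ ⊤ ∨ n₁ ≠ ⊤)
    (hd₂ : p₂ ≠ ⊤ ∨ n₂ ≠ ⊤) : (p₁ : EReal) - (n₁ : EReal) ≤ (p₂ : EReal) - (n₂ : EReal) := by
  by_cases hp₂ : p₂ = ⊤
  · have hn₂ : n₂ ≠ ⊤ := hd₂.resolve_left (not_not.2 hp₂)
    lift n₂ to NNReal using hn₂
    rw [hp₂, EReal.coe_ennreal_top, EReal.top_sub (by simp)]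
    exact le_top
  have ha₂' := ha₂.2 hp₂
  have ha₁' := ne_top_of_le_ne_top ha₂' ha
  have hp₁ := ha₁.1 ha₁'
  by_cases hn₁ : n₁ = ⊤
  · rw [hn₁, EReal.coe_ennreal_top, EReal.sub_top]
    exact bot_le
  have hb₁' := hb₁.2 hn₁
  have hb₂' := ne_top_of_le_ne_top hb₁' hb
  have hn₂ := hb₂.1 hb₂'
  lift p₁ to NNReal using hp₁
  lift n₁ to NNReal using hn₁
  lift p₂ to NNReal using hp₂
  lift n₂ to NNReal using hn₂
  lift a₁ to NNReal using ha₁'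
  lift b₁ to NNReal using hb₁'
  lift a₂ to NNReal using ha₂'
  lift b₂ to NNReal using hb₂'
  norm_cast at h₁ h₂ ha hb
  have e₁ : (p₁ : ℝ) + b₁ = a₁ + n₁ := by exact_mod_cast h₁
  have e₂ : (p₂ : ℝ) + b₂ = a₂ + n₂ := by exact_mod_cast h₂
  have e₃ : (a₁ : ℝ) ≤ a₂ := by exact_mod_cast ha
  have e₄ : (b₂ : ℝ) ≤ b₁ := by exact_mod_cast hb
  have e : ((p₁ : ℝ) : EReal) - ((n₁ : ℝ) : EReal) ≤ ((p₂ : ℝ) : EReal) - ((n₂ : ℝ) : EReal) := by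
    rw [← EReal.coe_sub, ← EReal.coe_sub, EReal.coe_le_coe_iff]
    linarith
  exact e

end Log

/-! ### The relative modular Hamiltonian -/

section Hamiltonian

variable {R R₁ R₂ : VonNeumannAlgebra H} {Ωt Ω : H}

theorem measurable_neg_log : Measurable fun x => -Real.log x := Real.measurable_log.neg

theorem isResolutionOf_spectralResolution (hΩ : IsStandard R Ω) :
    (spectralResolution (relModularOperator R Ωt Ω)).IsResolutionOf (relModularOperator R Ωt Ω) := by
  obtain ⟨E, hE⟩ := exists_isResolutionOf_relModularOperator (Ωt := Ωt) hΩ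
  rw [hE.spectralResolution_eq]
  exact hE

theorem graph_op_spectralResolution (hΩ : IsStandard R Ω) :
    ((spectralResolution (relModularOperator R Ωt Ω)).op fun x => x).graph =
      modularGraph R Ωt Ω := by
  have h := SpectralResolution.IsIntegral.eq_op measurable_id
    (isResolutionOf_spectralResolution (Ωt := Ωt) hΩ)
  rw [← graph_relModularOperator hΩ]
  exact (congrArg LinearPMap.graph h).symm

theorem ae_pos_relModularOperator (hΩ : IsStandard R Ω) (hΩt : IsStandard R Ωt) (ψ : H) :
    ∀ᵐ x ∂((spectralResolution (relModularOperator R Ωt Ω)).measure ψ), 0 < x := by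
  refine ae_pos_of_strictlyPositive (fun p hp h => ?_) ψ
  rw [graph_op_spectralResolution hΩ] at hp
  exact modularGraph_strictlyPositive hΩt hp h

theorem exists_resolvent_relModularOperator (hΩ : IsStandard R Ω) (hΩt : IsStandard R Ωt) {l : ℝ}
    (hl : 0 < l) (ψ : H) : ∃ w, (w, ψ - (l : ℂ) • w) ∈ modularGraph R Ωt Ω ∧
      (inner ℂ ψ w).re =
        ∫ x, (x + l)⁻¹ ∂((spectralResolution (relModularOperator R Ωt Ω)).measure ψ) := by
  obtain ⟨w, h1, h2⟩ := exists_resolvent_of_ae_pos (ae_pos_relModularOperator hΩ hΩt) hl ψ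
  rw [graph_op_spectralResolution hΩ] at h1
  exact ⟨w, h1, by rw [h2, Complex.ofReal_re]⟩

theorem isResolutionOf_relModularHamiltonian :
    ((spectralResolution (relModularOperator R Ωt Ω)).map _ measurable_neg_log).IsResolutionOf
      (relModularHamiltonian R Ωt Ω) :=
  isResolutionOf_functionalCalculus measurable_neg_log _

theorem formPos_relModularHamiltonian (ψ : H) : formPos (relModularHamiltonian R Ωt Ω) ψ =
    ∫⁻ x, ENNReal.ofReal (-Real.log x)
      ∂((spectralResolution (relModularOperator R Ωt Ω)).measure ψ) := by
  rw [formPos, isResolutionOf_relModularHamiltonian.spectralResolution_eq,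
    SpectralResolution.measure_map, lintegral_map (by fun_prop) measurable_neg_log]

theorem formNeg_relModularHamiltonian (ψ : H) : formNeg (relModularHamiltonian R Ωt Ω) ψ =
    ∫⁻ x, ENNReal.ofReal (Real.log x)
      ∂((spectralResolution (relModularOperator R Ωt Ω)).measure ψ) := by
  rw [formNeg, isResolutionOf_relModularHamiltonian.spectralResolution_eq,
    SpectralResolution.measure_map, lintegral_map (by fun_prop) measurable_neg_log]
  simp_rw [neg_neg]

theorem SpectralResolution.measureReal_univ (E : SpectralResolution H) (ψ : H) :
    (E.measure ψ).real univ = ‖ψ‖ ^ 2 := by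
  rw [Measure.real, E.measure_univ_eq, ENNReal.toReal_pow, toReal_enorm]

theorem wellDefined (hΩ : IsStandard R Ω) (hΩt : IsStandard R Ωt) : WellDefined R Ωt Ω where
  resolution := ⟨_, isResolutionOf_spectralResolution hΩ, fun _ h =>
    h.unique (isResolutionOf_spectralResolution hΩ)⟩
  pos := by
    set E := spectralResolution (relModularOperator R Ωt Ω) with hE
    have h1 := E.proj_union measurableSet_Iic measurableSet_Ioi
      (Iic_disjoint_Ioi (le_refl (0 : ℝ)))
    have h2 : E.proj (Iic 0) = 0 := by
      ext ψ
      have h3 : E.measure ψ (Iic 0) = 0 := by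
        have h4 := ae_pos_relModularOperator hΩ hΩt ψ
        rw [ae_iff] at h4
        simp only [not_lt] at h4
        exact h4
      rw [E.measure_apply_enorm measurableSet_Iic] at h3
      simpa using h3
    rw [Iic_union_Ioi, E.proj_univ, h2, zero_add] at h1
    exact h1.symm
  isLog := by
    rw [relModularHamiltonian, functionalCalculus_eq measurable_neg_log]
    exact SpectralResolution.isIntegral_op measurable_neg_log
  isSelfAdjoint := by
    rw [relModularHamiltonian, functionalCalculus_eq measurable_neg_log]
    exact SpectralResolution.isSelfAdjoint_op measurable_neg_log
  resolution_log := ⟨_, isResolutionOf_relModularHamiltonian, fun _ h =>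
    h.unique isResolutionOf_relModularHamiltonian⟩
  entropy := by
    have hpos := ae_pos_relModularOperator hΩ hΩt Ω
    rw [formNeg_relModularHamiltonian, ← lintegral_log_add_one_ne_top_iff hpos,
      lintegral_log_add_one hpos, SpectralResolution.measureReal_univ]
    -- Integrable majorant of `‖Ω‖²/l - ⟪Ω, (Δ + l)⁻¹ Ω⟫` on `(1, ∞)`.
    have h1 : IntegrableOn (fun l : ℝ => ‖Ωt‖ ^ 2 * l ^ (-2 : ℝ)) (Ioi 1) :=
      (integrableOn_Ioi_rpow_of_lt (by norm_num) one_pos).const_mul _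
    refine ne_top_of_le_ne_top h1.lintegral_lt_top.ne
      (setLIntegral_mono' measurableSet_Ioi fun l hl => ENNReal.ofReal_le_ofReal ?_)
    have hl' : 0 < l := zero_lt_one.trans hl
    obtain ⟨w, h2, h3⟩ := exists_resolvent_relModularOperator hΩ hΩt hl' Ω
    rw [← h3, Real.rpow_neg hl'.le, Real.rpow_ofNat, ← div_eq_mul_inv]
    exact resolvent_lower_bound hl' h2

theorem stieltjes_mono (hR : R₁ ≤ R₂) (hΩ₁ : IsStandard R₁ Ω) (hΩ₂ : IsStandard R₂ Ω)
    (hΩt₁ : IsStandard R₁ Ωt) (hΩt₂ : IsStandard R₂ Ωt) (ψ : H) {l : ℝ} (hl : 0 < l) :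
    ∫ x, (x + l)⁻¹ ∂((spectralResolution (relModularOperator R₁ Ωt Ω)).measure ψ) ≤
      ∫ x, (x + l)⁻¹ ∂((spectralResolution (relModularOperator R₂ Ωt Ω)).measure ψ) := by
  obtain ⟨w₁, h1, h1'⟩ := exists_resolvent_relModularOperator hΩ₁ hΩt₁ hl ψ
  obtain ⟨w₂, h2, h2'⟩ := exists_resolvent_relModularOperator hΩ₂ hΩt₂ hl ψ
  rw [← h1', ← h2']
  exact resolvent_mono hR hl h1 h2

theorem formLE_relModularHamiltonian (hR : R₁ ≤ R₂) (hΩ₁ : IsStandard R₁ Ω)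
    (hΩ₂ : IsStandard R₂ Ω) (hΩt₁ : IsStandard R₁ Ωt) (hΩt₂ : IsStandard R₂ Ωt) :
    FormLE (relModularHamiltonian R₁ Ωt Ω) (relModularHamiltonian R₂ Ωt Ω) := by
  have hp₁ := ae_pos_relModularOperator hΩ₁ hΩt₁
  have hp₂ := ae_pos_relModularOperator hΩ₂ hΩt₂
  have hr := stieltjes_mono hR hΩ₁ hΩ₂ hΩt₁ hΩt₂
  set E₁ := spectralResolution (relModularOperator R₁ Ωt Ω)
  set E₂ := spectralResolution (relModularOperator R₂ Ωt Ω)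
  have ha : ∀ ψ, ∫⁻ x, ENNReal.ofReal (Real.log (x + 1) - Real.log x) ∂(E₁.measure ψ) ≤
      ∫⁻ x, ENNReal.ofReal (Real.log (x + 1) - Real.log x) ∂(E₂.measure ψ) := fun ψ => by
    rw [lintegral_log_sub_log (hp₁ ψ), lintegral_log_sub_log (hp₂ ψ)]
    exact setLIntegral_mono' measurableSet_Ioc fun l hl => ENNReal.ofReal_le_ofReal (hr ψ hl.1)
  -- The order reverses: the Stieltjes transform enters with a minus sign, against the common mass
  -- `‖ψ‖²`.
  have hb : ∀ ψ, ∫⁻ x, ENNReal.ofReal (Real.log (x + 1)) ∂(E₂.measure ψ) ≤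
      ∫⁻ x, ENNReal.ofReal (Real.log (x + 1)) ∂(E₁.measure ψ) := fun ψ => by
    rw [lintegral_log_add_one (hp₁ ψ), lintegral_log_add_one (hp₂ ψ),
      SpectralResolution.measureReal_univ, SpectralResolution.measureReal_univ]
    exact setLIntegral_mono' measurableSet_Ioi fun l hl => ENNReal.ofReal_le_ofReal
      (sub_le_sub_left (hr ψ (zero_lt_one.trans hl)) _)
  refine ⟨fun ψ h => ?_, fun ψ h => ?_, fun ψ h₁ h₂ => ?_⟩
  · rw [formPos_relModularHamiltonian, ← lintegral_log_sub_log_ne_top_iff (hp₂ ψ)] at h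
    rw [formPos_relModularHamiltonian, ← lintegral_log_sub_log_ne_top_iff (hp₁ ψ)]
    exact ne_top_of_le_ne_top h (ha ψ)
  · rw [formNeg_relModularHamiltonian, ← lintegral_log_add_one_ne_top_iff (hp₁ ψ)] at h
    rw [formNeg_relModularHamiltonian, ← lintegral_log_add_one_ne_top_iff (hp₂ ψ)]
    exact ne_top_of_le_ne_top h (hb ψ)
  · rw [FormDefined, formPos_relModularHamiltonian, formNeg_relModularHamiltonian] at h₁ h₂
    rw [quadForm, quadForm, formPos_relModularHamiltonian, formNeg_relModularHamiltonian,
      formPos_relModularHamiltonian, formNeg_relModularHamiltonian]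
    exact coe_sub_coe_le_coe_sub_coe (lintegral_log_identity (hp₁ ψ))
      (lintegral_log_identity (hp₂ ψ)) (ha ψ) (hb ψ) (lintegral_log_sub_log_ne_top_iff (hp₁ ψ))
      (lintegral_log_sub_log_ne_top_iff (hp₂ ψ)) (lintegral_log_add_one_ne_top_iff (hp₁ ψ))
      (lintegral_log_add_one_ne_top_iff (hp₂ ψ)) h₁ h₂

end Hamiltonian

end ModularTheory

end

theorem mainTheorem4 {H : Type*} [NormedAddCommGroup H] [InnerProductSpace ℂ H] [CompleteSpace H]
    (R₁ R₂ : VonNeumannAlgebra H) (hR : R₁ ≤ R₂) (Ω Ωt : H)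
    (hΩ₁ : IsStandard R₁ Ω) (hΩ₂ : IsStandard R₂ Ω)
    (hΩt₁ : IsStandard R₁ Ωt) (hΩt₂ : IsStandard R₂ Ωt) :
    (WellDefined R₁ Ωt Ω ∧ WellDefined R₂ Ωt Ω) ∧
    FormLE (relModularHamiltonian R₁ Ωt Ω) (relModularHamiltonian R₂ Ωt Ω) ∧
    relEntropy R₁ Ω Ωt ≤ relEntropy R₂ Ω Ωt := by
  have h₁ := wellDefined hΩ₁ hΩt₁
  have h₂ := wellDefined hΩ₂ hΩt₂
  have h := formLE_relModularHamiltonian hR hΩ₁ hΩ₂ hΩt₁ hΩt₂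
  exact ⟨⟨h₁, h₂⟩, h, h.le Ω (Or.inr h₁.entropy) (Or.inr h₂.entropy)⟩
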